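/- **Setting.** Let $n\ge 1$, let $F^2(H_n)=\bigoplus_{k\ge 0}H_n^{\otimes k}$ be the full Fock space of an $n$-dimensional Hilbert space with orthonormal basis $e_1,\dots,e_n$, with orthonormal basis $e_\alpha=e_{i_1}\otimes\cdots\otimes e_{i_k}$ indexed by the words $\alpha=g_{i_1}\cdots g_{i_k}$ in $n$ letters (and $e_\alpha=1$ for the empty word). Let $S_i\varphi=e_i\otimes\varphi$ be the left creation operators and let $F_n^\infty$ be the WOT-closed algebra generated by $S_1,\dots,S_n$ and the identity. Each $f\in F_n^\infty$ has Fourier coefficients $a_\alpha$ determined by $f\,1=\sum_\alpha a_\alpha e_\alpha$. For operators $T_1,\dots,T_n$ write $T_\alpha=T_{i_1}\cdots T_{i_k}$, and, whenever the norm-convergent series and the limit exist, $$f(T_1,\dots,T_n)=\text{SOT-}\lim_{r\uparrow 1}\ \sum_{k=0}^\infty\sum_{|\alpha|=k}r^{|\alpha|}a_\alpha T_\alpha .$$ Let $J\ne F_n^\infty$ be a WOT-closed two-sided ideal of $F_n^\infty$, let $\mathcal N_J=F^2(H_n)\ominus\overline{JF^2(H_n)}$ (with $JF^2(H_n)$ the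 linear span of all $\varphi x$, $\varphi\in J$, $x\in F^2(H_n)$), let $B_i=P_{\mathcal N_J}S_i|_{\mathcal N_J}$, and let $\mathcal W(B_1,\dots,B_n)$ be the $w^*$-closed algebra generated by $B_1,\dots,B_n$ and the identity of $\mathcal N_J$. Let $T=[T_1,\dots,T_n]$ be a row contraction on a complex Hilbert space $\mathcal H$, that is, $\sum_iT_iT_i^*\le I$. Assume that $T$ is completely non-coisometric: there is no $h\neq 0$ in $\mathcal H$ with $\sum_{|\alpha|=k}\|T_\alpha^*h\|^2=\|h\|^2$ for all $k\ge 1$. Put $\Delta_T=(I-\sum_iT_iT_i^*)^{1/2}$, $\mathcal D_T=\overline{\Delta_T\mathcal H}$, and define $$K_Th=\sum_\alpha e_\alpha\otimes\Delta_TT_\alpha^*h\in F^2(H_n)\otimes\mathcal D_T,\qquad K_{J,T}=(P_{\mathcal N_J}\otimes I_{\mathcal D_T})K_T:\mathcal H\to\mathcal N_J\otimes\mathcal D_T .$$ **Theorem.** Assume that $\varphi(T_1,\dots,T_n)=0$ for all $\varphi\in J$. Then $f(T_1,\dots,T_n)$ and $f(B_1,\dots,B_n)$ exist for every $f\in F_n^\infty$,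 one has $$\mathcal W(B_1,\dots,B_n)=\{f(B_1,\dots,B_n): f\in F_n^\infty\},$$ and $$K_{J,T}\,f(T_1,\dots,T_n)^*=\bigl(f(B_1,\dots,B_n)^*\otimes I_{\mathcal D_T}\bigr)K_{J,T}$$ for every $f(B_1,\dots,B_n)\in\mathcal W(B_1,\dots,B_n)$. -/

import Mathlib

open scoped TensorProduct InnerProductSpace Topology
open Filter

noncomputable section

namespace ConstrainedShift

/-! ### Words and the full Fock space -/

/-- The free semigroup on `n` generators: words `α = g_{i₁} ⋯ g_{i_k}`, with the empty word as
identity. -/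
abbrev Word (n : ℕ) : Type := List (Fin n)

section Words

variable {n : ℕ} {E : Type*} [NormedAddCommGroup E] [InnerProductSpace ℂ E]

/-- `T_α = T_{i₁} ⋯ T_{i_k}` for `α = g_{i₁} ⋯ g_{i_k}`, and `T_∅ = I`. -/
def wordOp (T : Fin n → E →L[ℂ] E) (α : Word n) : E →L[ℂ] E := (α.map T).prod

end Words

/-- The full Fock space `F²(H_n) = ⨁_{k ≥ 0} H_n^{⊗ k}` of an `n`-dimensional Hilbert space with
orthonormal basis `e_1, …, e_n`, described in its orthonormal basis
`e_α = e_{i₁} ⊗ ⋯ ⊗ e_{i_k}`, indexed by words: `φ = ∑_α φ(α) e_α`, `∑_α |φ(α)|² < ∞`. -/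
abbrev Fock (n : ℕ) : Type := lp (fun _ : Word n => ℂ) 2

/-- The basis vector `e_α`; `fockBasis []` is the vacuum vector `1`. -/
def fockBasis {n : ℕ} (α : Word n) : Fock n := lp.single 2 α (1 : ℂ)

theorem orthonormal_fockBasis {n : ℕ} : Orthonormal ℂ (fockBasis : Word n → Fock n) := by
  rw [orthonormal_iff_ite]
  intro α β
  simp only [fockBasis, lp.inner_single_left, lp.single_apply]
  by_cases h : α = β
  · subst h; simp
  · simp [h]

theorem orthonormal_fockBasis_cons {n : ℕ} (i : Fin n) :
    Orthonormal ℂ (fun α : Word n => (fockBasis (i :: α) : Fock n)) :=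
  orthonormal_fockBasis.comp (fun α : Word n => i :: α) (List.cons_injective)

/-- The left creation operator `S_i φ = e_i ⊗ φ`, i.e. the isometry with `S_i e_α = e_{g_i α}`:
`S_i φ = ∑_α φ(α) e_{g_i α}`. -/
def leftCreation {n : ℕ} (i : Fin n) : Fock n →L[ℂ] Fock n :=
  (orthonormal_fockBasis_cons i).orthogonalFamily.linearIsometry.toContinuousLinearMap

theorem leftCreation_fockBasis {n : ℕ} (i : Fin n) (α : Word n) :
    leftCreation i (fockBasis α) = fockBasis (i :: α) := by
  simp [leftCreation, fockBasis]

/-! ### Operator topologies and the noncommutative analytic Toeplitz algebra -/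

section Topologies

variable {E : Type*} [NormedAddCommGroup E] [InnerProductSpace ℂ E]

/-- A set of operators is WOT-closed if it is closed in the weak operator topology. -/
def IsWOTClosed (s : Set (E →L[ℂ] E)) : Prop :=
  IsClosed ((fun A : E →WOT[ℂ] E => A.toCLM) ⁻¹' s)

variable (E) in
/-- The `w*`-topology (ultraweak topology) of `B(E)`: the coarsest topology for which the
functionals `A ↦ ∑_k ⟨A x_k, y_k⟩`, with `∑_k ‖x_k‖² < ∞` and `∑_k ‖y_k‖² < ∞`, are
continuous. -/
abbrev weakStarTopology : TopologicalSpace (E →L[ℂ] E) :=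
  ⨅ (x : lp (fun _ : ℕ => E) 2) (y : lp (fun _ : ℕ => E) 2),
    TopologicalSpace.induced (fun A : E →L[ℂ] E => ∑' k, ⟪y k, A (x k)⟫_ℂ) inferInstance

/-- A set of operators is `w*`-closed. -/
def IsWeakStarClosed (s : Set (E →L[ℂ] E)) : Prop :=
  @IsClosed _ (weakStarTopology E) s

/-- The `w*`-closed algebra generated by `B_1, …, B_n` and the identity: the smallest `w*`-closed
unital algebra containing `B_1, …, B_n`. -/
def weakStarAlgebra {n : ℕ} (B : Fin n → E →L[ℂ] E) : Subalgebra ℂ (E →L[ℂ] E) :=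
  sInf {𝒜 | IsWeakStarClosed (𝒜 : Set (E →L[ℂ] E)) ∧ ∀ i, B i ∈ 𝒜}

end Topologies

/-- The noncommutative analytic Toeplitz algebra `F_n^∞`: the smallest WOT-closed unital algebra of
operators on the Fock space that contains the left creation operators. -/
def toeplitzAlgebra (n : ℕ) : Subalgebra ℂ (Fock n →L[ℂ] Fock n) :=
  sInf {𝒜 | IsWOTClosed (𝒜 : Set (Fock n →L[ℂ] Fock n)) ∧ ∀ i, leftCreation i ∈ 𝒜}

/-- The Fourier coefficients `a_α` of `f = ∑_α a_α S_α ∈ F_n^∞`, characterized by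
`f 1 = ∑_α a_α e_α`. -/
def fourierCoeff {n : ℕ} (f : toeplitzAlgebra n) (α : Word n) : ℂ :=
  ((f : Fock n →L[ℂ] Fock n) (fockBasis [])) α

/-! ### The functional calculus -/

section Calculus

variable {n : ℕ} {E : Type*} [NormedAddCommGroup E] [InnerProductSpace ℂ E]

/-- The homogeneous part `∑_{|α| = k} r^k a_α T_α` of `f(rT)`. -/
def homogeneousPart (f : toeplitzAlgebra n) (T : Fin n → E →L[ℂ] E) (r : ℝ) (k : ℕ) :
    E →L[ℂ] E :=
  ∑ w : Fin k → Fin n,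
    ((r : ℂ) ^ k * fourierCoeff f (List.ofFn w)) • wordOp T (List.ofFn w)

/-- `f(T) = A` in the `F_n^∞`-functional calculus: for `0 < r < 1` the series
`f(rT) = ∑_k ∑_{|α| = k} r^{|α|} a_α T_α` converges in norm, and `f(rT) → A` in the strong operator
topology as `r → 1`, `r < 1`. -/
structure HasFunctionalCalculus (f : toeplitzAlgebra n) (T : Fin n → E →L[ℂ] E)
    (A : E →L[ℂ] E) : Prop where
  summable : ∀ r ∈ Set.Ioo (0 : ℝ) 1, Summable (homogeneousPart f T r)
  tendsto : ∀ x : E,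
    Tendsto (fun r : ℝ => (∑' k, homogeneousPart f T r k) x) (𝓝[<] 1) (𝓝 (A x))

end Calculus

/-! ### Constrained shifts -/

section Constrained

variable {n : ℕ}

/-- `𝓜_J`, the closed linear span of `J F²(H_n) = {φ x : φ ∈ J, x ∈ F²(H_n)}`. -/
def idealSpace (J : TwoSidedIdeal (toeplitzAlgebra n)) : Submodule ℂ (Fock n) :=
  (Submodule.span ℂ
    {y | ∃ φ ∈ J, ∃ x : Fock n, (φ : Fock n →L[ℂ] Fock n) x = y}).topologicalClosure

/-- `𝓝_J = F²(H_n) ⊖ 𝓜_J`. -/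
abbrev constrainedSpace (J : TwoSidedIdeal (toeplitzAlgebra n)) : Submodule ℂ (Fock n) :=
  (idealSpace J)ᗮ

/-- The orthogonal projection of `F²(H_n)` onto `𝓝_J`, as a map into `𝓝_J`. -/
def constrainedProj (J : TwoSidedIdeal (toeplitzAlgebra n)) : Fock n →L[ℂ] constrainedSpace J :=
  (constrainedSpace J).orthogonalProjectionOnto

/-- The constrained left creation operators `B_i = P_{𝓝_J} S_i |_{𝓝_J}`. -/
def constrainedShift (J : TwoSidedIdeal (toeplitzAlgebra n)) (i : Fin n) :
    constrainedSpace J →L[ℂ] constrainedSpace J :=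
  constrainedProj J ∘L leftCreation i ∘L (constrainedSpace J).subtypeL

end Constrained

/-! ### Hilbert space tensor products -/

section Tensor

variable {E F E' F' : Type*}
  [NormedAddCommGroup E] [InnerProductSpace ℂ E] [NormedAddCommGroup F] [InnerProductSpace ℂ F]
  [NormedAddCommGroup E'] [InnerProductSpace ℂ E'] [NormedAddCommGroup F']
  [InnerProductSpace ℂ F']

variable (E F) in
/-- The Hilbert space tensor product: the completion of the algebraic tensor product for
`⟨x ⊗ y, x' ⊗ y'⟩ = ⟨x, x'⟩ ⟨y, y'⟩`. -/
abbrev HilbertTensor : Type _ := UniformSpace.Completion (E ⊗[ℂ] F)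

/-- The elementary tensor `x ⊗ y`. -/
def tensor (x : E) (y : F) : HilbertTensor E F := ((x ⊗ₜ[ℂ] y : E ⊗[ℂ] F) : HilbertTensor E F)

theorem tensor_add (x : E) (y y' : F) : tensor x (y + y') = tensor x y + tensor x y' := by
  rw [tensor, TensorProduct.tmul_add, UniformSpace.Completion.coe_add]; rfl

theorem tensor_smul (c : ℂ) (x : E) (y : F) : tensor x (c • y) = c • tensor x y := by
  rw [tensor, TensorProduct.tmul_smul, UniformSpace.Completion.coe_smul]; rfl

/-- The bounded operator `A ⊗ C` on Hilbert space tensor products. -/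
def tensorOp (A : E →L[ℂ] E') (C : F →L[ℂ] F') : HilbertTensor E F →L[ℂ] HilbertTensor E' F' :=
  (TensorProduct.mapL A C).completion

theorem tensorOp_tensor (A : E →L[ℂ] E') (C : F →L[ℂ] F') (x : E) (y : F) :
    tensorOp A C (tensor x y) = tensor (A x) (C y) := by
  simp [tensorOp, tensor]

/-- `y ↦ x ⊗ y` is isometric for a unit vector `x`. -/
def tensorLeft (x : E) (hx : ‖x‖ = 1) : F →ₗᵢ[ℂ] HilbertTensor E F where
  toFun y := tensor x y
  map_add' y y' := tensor_add x y y'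
  map_smul' c y := tensor_smul c x y
  norm_map' y := by
    change ‖tensor x y‖ = ‖y‖
    rw [tensor, UniformSpace.Completion.norm_coe, TensorProduct.norm_tmul, hx, one_mul]

end Tensor

/-! ### Row contractions and Poisson kernels -/

section Row

variable {n : ℕ} {H : Type*} [NormedAddCommGroup H] [InnerProductSpace ℂ H] [CompleteSpace H]

/-- `T_1 T_1^* + ⋯ + T_n T_n^* ≤ I`. -/
def IsRowContraction (T : Fin n → H →L[ℂ] H) : Prop :=
  ∑ i, T i ∘L (T i).adjoint ≤ 1

/-- `T` is completely non-coisometric: no `h ≠ 0` satisfies `∑_{|α| = k} ‖T_α^* h‖² = ‖h‖²` for all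
`k = 1, 2, …`. -/
def IsCompletelyNonCoisometric (T : Fin n → H →L[ℂ] H) : Prop :=
  ¬ ∃ h : H, h ≠ 0 ∧ ∀ k : ℕ, 1 ≤ k →
    ∑ w : Fin k → Fin n, ‖(wordOp T (List.ofFn w)).adjoint h‖ ^ 2 = ‖h‖ ^ 2

/-- The defect operator `Δ_T = (I - T_1 T_1^* - ⋯ - T_n T_n^*)^{1/2}`. -/
def defect (T : Fin n → H →L[ℂ] H) : H →L[ℂ] H :=
  CFC.sqrt (1 - ∑ i, T i ∘L (T i).adjoint)

/-- The defect space, the closure of the range of `Δ_T`. -/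
def defectSpace (T : Fin n → H →L[ℂ] H) : Submodule ℂ H :=
  (LinearMap.range (defect T).toLinearMap).topologicalClosure

/-- `Δ_T` as a map into the defect space. -/
def defectMap (T : Fin n → H →L[ℂ] H) : H →L[ℂ] defectSpace T :=
  (defect T).codRestrict (defectSpace T)
    (fun h => Submodule.le_topologicalClosure _ ⟨h, rfl⟩)

theorem norm_defect_sq {T : Fin n → H →L[ℂ] H} (hT : IsRowContraction T) (h : H) :
    ‖defectMap T h‖ ^ 2 = ‖h‖ ^ 2 - ∑ i, ‖(T i).adjoint h‖ ^ 2 := by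
  have hpos : (0 : H →L[ℂ] H) ≤ 1 - ∑ i, T i ∘L (T i).adjoint := sub_nonneg.2 hT
  have hsq : defect T * defect T = 1 - ∑ i, T i ∘L (T i).adjoint :=
    CFC.sqrt_mul_sqrt_self _ hpos
  have hsa : (defect T).adjoint = defect T :=
    (IsSelfAdjoint.of_nonneg (CFC.sqrt_nonneg _)).star_eq
  have hn : ‖defectMap T h‖ = ‖defect T h‖ := rfl
  have key : ((‖defect T h‖ ^ 2 : ℝ) : ℂ)
      = ((‖h‖ ^ 2 - ∑ i, ‖(T i).adjoint h‖ ^ 2 : ℝ) : ℂ) := by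
    push_cast
    have h1 : ((‖defect T h‖ : ℂ)) ^ 2 = ⟪h, (defect T * defect T) h⟫_ℂ := by
      refine (inner_self_eq_norm_sq_to_K (𝕜 := ℂ) (defect T h)).symm.trans ?_
      change _ = ⟪h, defect T (defect T h)⟫_ℂ
      have h2 := ContinuousLinearMap.adjoint_inner_left (defect T) (defect T h) h
      rwa [hsa] at h2
    rw [h1, hsq]
    simp only [sub_apply, one_apply_eq_self, inner_sub_right,
      sum_apply, inner_sum, ContinuousLinearMap.comp_apply]
    congr 1
    · exact inner_self_eq_norm_sq_to_K (𝕜 := ℂ) h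
    · refine Finset.sum_congr rfl fun i _ => ?_
      rw [← ContinuousLinearMap.adjoint_inner_left]
      exact inner_self_eq_norm_sq_to_K (𝕜 := ℂ) _
  rw [hn]
  exact_mod_cast key

/-- The component `Δ_T T_α^* h` of the Poisson kernel. -/
def poissonCoeff (T : Fin n → H →L[ℂ] H) (α : Word n) : H →L[ℂ] defectSpace T :=
  defectMap T ∘L (wordOp T α).adjoint

theorem poissonCoeff_cons (T : Fin n → H →L[ℂ] H) (i : Fin n) (α : Word n) (h : H) :
    poissonCoeff T (i :: α) h = poissonCoeff T α ((T i).adjoint h) := by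
  have : (wordOp T (i :: α)).adjoint = (wordOp T α).adjoint ∘L (T i).adjoint := by
    rw [← ContinuousLinearMap.adjoint_comp]; simp [wordOp, ContinuousLinearMap.mul_def]
  simp [poissonCoeff, this]

theorem poissonCoeff_partial_sum_le {T : Fin n → H →L[ℂ] H} (hT : IsRowContraction T) (m : ℕ) :
    ∀ h : H, ∑ k ∈ Finset.range m, ∑ w : Fin k → Fin n, ‖poissonCoeff T (List.ofFn w) h‖ ^ 2
      ≤ ‖h‖ ^ 2 := by
  induction m with
  | zero => intro h; simp
  | succ m ih =>
    intro h
    have hstep : ∀ k, ∑ w : Fin (k + 1) → Fin n, ‖poissonCoeff T (List.ofFn w) h‖ ^ 2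
        = ∑ i, ∑ w : Fin k → Fin n, ‖poissonCoeff T (List.ofFn w) ((T i).adjoint h)‖ ^ 2 := by
      intro k
      rw [← (Fin.consEquiv (fun _ : Fin (k + 1) => Fin n)).sum_comp, Fintype.sum_prod_type]
      simp [Fin.consEquiv, List.ofFn_succ, poissonCoeff_cons]
    rw [Finset.sum_range_succ']
    simp only [hstep]
    rw [Finset.sum_comm]
    have h0 : ∑ w : Fin 0 → Fin n, ‖poissonCoeff T (List.ofFn w) h‖ ^ 2
        = ‖h‖ ^ 2 - ∑ i, ‖(T i).adjoint h‖ ^ 2 := by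
      rw [← norm_defect_sq hT]
      have h1 : (ContinuousLinearMap.id ℂ H).adjoint = ContinuousLinearMap.id ℂ H :=
        star_one (H →L[ℂ] H)
      simp [poissonCoeff, wordOp, ContinuousLinearMap.one_def, h1]
    rw [h0]
    have := Finset.sum_le_sum (s := Finset.univ) fun i _ => ih ((T i).adjoint h)
    linarith

theorem poissonCoeff_summable {T : Fin n → H →L[ℂ] H} (hT : IsRowContraction T) (h : H) :
    (Summable fun α : Word n => ‖poissonCoeff T α h‖ ^ 2) ∧
      ∑' α : Word n, ‖poissonCoeff T α h‖ ^ 2 ≤ ‖h‖ ^ 2 := by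
  have hs : Summable fun p : (Σ k, Fin k → Fin n) => ‖poissonCoeff T (List.ofFn p.2) h‖ ^ 2 := by
    refine (summable_sigma_of_nonneg fun _ => by positivity).2 ⟨fun k => .of_finite, ?_⟩
    simp only [tsum_fintype]
    exact summable_of_sum_range_le (fun k => by positivity)
      fun m => poissonCoeff_partial_sum_le hT m h
  have he : (fun α : Word n => ‖poissonCoeff T α h‖ ^ 2) ∘ List.equivSigmaTuple.symm
      = fun p : (Σ k, Fin k → Fin n) => ‖poissonCoeff T (List.ofFn p.2) h‖ ^ 2 := rfl
  refine ⟨(List.equivSigmaTuple.symm.summable_iff).1 (he ▸ hs), ?_⟩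
  rw [← List.equivSigmaTuple.symm.tsum_eq (fun α : Word n => ‖poissonCoeff T α h‖ ^ 2)]
  change ∑' p : (Σ k, Fin k → Fin n), ‖poissonCoeff T (List.ofFn p.2) h‖ ^ 2 ≤ _
  rw [hs.tsum_sigma' fun _ => .of_finite]
  simp only [tsum_fintype]
  exact Real.tsum_le_of_sum_range_le (fun k => by positivity)
    fun m => poissonCoeff_partial_sum_le hT m h

theorem orthogonalFamily_fockTensor (F : Type*) [NormedAddCommGroup F] [InnerProductSpace ℂ F] :
    OrthogonalFamily ℂ (fun _ : Word n => F)
      (fun α => tensorLeft (F := F) (fockBasis α : Fock n) (orthonormal_fockBasis.1 α)) := by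
  intro α β hαβ x y
  change ⟪tensor (fockBasis α : Fock n) x, tensor (fockBasis β : Fock n) y⟫_ℂ = 0
  rw [tensor, tensor, UniformSpace.Completion.inner_coe, TensorProduct.inner_tmul,
    orthonormal_fockBasis.2 hαβ, zero_mul]

theorem poisson_summable {T : Fin n → H →L[ℂ] H} (hT : IsRowContraction T) (h : H) :
    Summable fun α : Word n => tensor (fockBasis α : Fock n) (poissonCoeff T α h) :=
  ((orthogonalFamily_fockTensor (defectSpace T)).summable_iff_norm_sq_summable
    (fun α => poissonCoeff T α h)).2 (poissonCoeff_summable hT h).1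

theorem poisson_norm_le {T : Fin n → H →L[ℂ] H} (hT : IsRowContraction T) (h : H) :
    ‖∑' α : Word n, tensor (fockBasis α : Fock n) (poissonCoeff T α h)‖ ≤ 1 * ‖h‖ := by
  rw [one_mul]
  refine le_of_tendsto (poisson_summable hT h).hasSum.norm (Eventually.of_forall fun s => ?_)
  refine le_of_sq_le_sq ?_ (norm_nonneg _)
  have := (orthogonalFamily_fockTensor (n := n) (defectSpace T)).norm_sum
    (fun α => poissonCoeff T α h) s
  change ‖∑ α ∈ s, tensor (fockBasis α : Fock n) (poissonCoeff T α h)‖ ^ 2 = _ at this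
  rw [this]
  exact ((poissonCoeff_summable hT h).1.sum_le_tsum s fun _ _ => by positivity).trans
    (poissonCoeff_summable hT h).2

/-- The Poisson kernel `K_T h = ∑_α e_α ⊗ Δ_T T_α^* h` of a row contraction. -/
def poissonKernel (T : Fin n → H →L[ℂ] H) (hT : IsRowContraction T) :
    H →L[ℂ] HilbertTensor (Fock n) (defectSpace T) :=
  LinearMap.mkContinuous
    { toFun := fun h => ∑' α : Word n, tensor (fockBasis α : Fock n) (poissonCoeff T α h)
      map_add' := fun h h' => by
        rw [← (poisson_summable hT h).tsum_add (poisson_summable hT h')]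
        simp only [map_add, tensor_add]
      map_smul' := fun c h => by
        rw [RingHom.id_apply, ← (poisson_summable hT h).tsum_const_smul c]
        simp only [map_smul, tensor_smul] }
    1 (poisson_norm_le hT)

/-- The constrained Poisson kernel `K_{J,T} = (P_{𝓝_J} ⊗ I) K_T`. -/
def constrainedPoissonKernel (J : TwoSidedIdeal (toeplitzAlgebra n)) (T : Fin n → H →L[ℂ] H)
    (hT : IsRowContraction T) : H →L[ℂ] HilbertTensor (constrainedSpace J) (defectSpace T) :=
  tensorOp (constrainedProj J) (ContinuousLinearMap.id ℂ (defectSpace T)) ∘L poissonKernel T hT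

end Row

end ConstrainedShift

end

/-!
Let `R_i` be the right creation operators `e_α ↦ e_{α g_i}`. Everything rests on describing
`F_n^∞` as the commutant of `R_1, …, R_n` (`toeplitzAlgebra_le_rightCommutant` and
`rightCommutant_le_toeplitzAlgebra`): an operator `f` commuting with them is determined by the
vector `f 1`, and its dilations `f(rS)` are norm limits of polynomials in the left creation
operators, are bounded by `‖f‖`, and converge strongly to `f`.

*Functional calculus.* If `A = ∑ a_α T_α` converges in norm and `f` has coefficients `a_α`, then
`A K_T^* = K_T^* (f ⊗ I)` (`apply_adjoint_poissonKernel`). Applied to the pure row contraction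
`rT`, whose Poisson kernel is an isometry, this gives von Neumann's inequality `‖f(rT)‖ ≤ ‖f‖`.
Applied to `f(rS)` and `T`, it shows that `f(rT)` converges strongly on the range of `K_T^*`. If `T`
is completely non-coisometric then `K_T` is injective, so this range is dense, and the limit `f(T)`
exists and satisfies `f(T) K_T^* = K_T^* (f ⊗ I)`. If `φ(T) = 0` for all `φ ∈ J`, then `K_T^*`
vanishes on `𝓜_J ⊗ 𝓓_T`, and compressing to `𝓝_J ⊗ 𝓓_T` gives the identity for `K_{J,T}`.
Since `𝓜_J` is invariant under the left creation operators, `f(rB)` is the compression of `f(rS)`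
and `f(B)` is the compression of `f`.

*The algebra `𝓦(B_1, …, B_n)`.* Bounded strong limits are `w*`-limits, so it contains all `f(B)`.
Conversely, `𝓜_J` is invariant under every `R_i` as well, so each `B_j` commutes with the
compressions of the `R_i`, and the commutant of the latter is `w*`-closed; hence it contains
`𝓦(B_1, …, B_n)`. By commutant lifting (`exists_compression_eq`) each operator `X` in this commutant
is the compression of an operator commuting with the `R_i`, that is, of some `f ∈ F_n^∞`.

The lifting is obtained from a lurking isometry. With `A = X^*`, scaled to a contraction, and
`δ = (1 - A^* A)^{1/2}`, splitting off the vacuum coefficient gives, for `y ∈ 𝓝_J`,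
`‖δ y‖² + |(A y)_∅|² = ∑ ‖δ R_i^* y‖² + |y_∅|²`. So there is a contractive colligation taking
`((δ R_i^* y)_i, y_∅)` to `(δ y, (A y)_∅)`. Its transfer operator is a contraction on the whole
Fock space that commutes with the `R_i^*`, and it extends `A` because the `R_i^*` are pure.
-/

noncomputable section

namespace ConstrainedShift

/-! ### Sums over words -/

section WordSums

variable {n : ℕ}

theorem sum_words_succ {M : Type*} [AddCommMonoid M] (F : Word n → M) (k : ℕ) :
    ∑ w : Fin (k + 1) → Fin n, F (List.ofFn w)
      = ∑ i, ∑ w : Fin k → Fin n, F (List.ofFn w ++ [i]) := by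
  rw [← (Fin.snocEquiv (fun _ : Fin (k + 1) => Fin n)).sum_comp, Fintype.sum_prod_type]
  simp [Fin.snocEquiv, List.ofFn_succ', List.concat_eq_append, -List.ofFn_succ]

theorem hasSum_levels {M : Type*} [AddCommMonoid M] [TopologicalSpace M] [RegularSpace M]
    [ContinuousAdd M]
    {F : Word n → M} {s : M} (h : HasSum F s) :
    HasSum (fun k => ∑ w : Fin k → Fin n, F (List.ofFn w)) s := by
  have h1 : HasSum (fun p : (Σ k, Fin k → Fin n) => F (List.ofFn p.2)) s :=
    (List.equivSigmaTuple.symm.hasSum_iff).2 h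
  exact h1.sigma fun k => hasSum_fintype _

/-- Nonnegative quantities indexed by words are summable as soon as the sums over the words of
length less than `m` are bounded. -/
theorem summable_of_levels_le {F : Word n → ℝ} {c : ℝ} (hF : ∀ α, 0 ≤ F α)
    (h : ∀ m, ∑ k ∈ Finset.range m, ∑ w : Fin k → Fin n, F (List.ofFn w) ≤ c) :
    Summable F ∧ ∑' α, F α ≤ c := by
  have hs : Summable fun p : (Σ k, Fin k → Fin n) => F (List.ofFn p.2) := by
    refine (summable_sigma_of_nonneg fun _ => hF _).2 ⟨fun k => .of_finite, ?_⟩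
    simp only [tsum_fintype]
    exact summable_of_sum_range_le (fun k => Finset.sum_nonneg fun _ _ => hF _) h
  have hsF : Summable F := (List.equivSigmaTuple.symm.summable_iff).1 hs
  refine ⟨hsF, ?_⟩
  have := hasSum_levels hsF.hasSum
  rw [← this.tsum_eq]
  exact Real.tsum_le_of_sum_range_le (fun k => Finset.sum_nonneg fun _ _ => hF _) h

/-- Energy estimate for a discrete-time system on words: if the stored energy `N` decreases by at
least the output energy `q` when it is distributed over the `n` successors `L i x` of a state `x`,
then the total output along all words is at most the initial energy. -/
theorem summable_of_energy {X : Type*} {L : Fin n → X → X} {q N : X → ℝ} (hq : ∀ x, 0 ≤ q x)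
    (hN : ∀ x, 0 ≤ N x) (h : ∀ x, q x + ∑ i, N (L i x) ≤ N x) (x : X) :
    (Summable fun α : Word n => q (α.foldr L x)) ∧ ∑' α : Word n, q (α.foldr L x) ≤ N x := by
  refine summable_of_levels_le (fun _ => hq _) fun m => ?_
  induction m generalizing x with
  | zero => simpa using hN x
  | succ m ih =>
    rw [Finset.sum_range_succ']
    simp only [sum_words_succ fun α : Word n => q (α.foldr L x)]
    rw [Finset.sum_comm]
    have h1 := Finset.sum_le_sum (s := Finset.univ) fun i _ => ih (L i x)
    have h2 := h x
    simp only [List.foldr_append, List.foldr_cons, List.foldr_nil, List.ofFn_zero,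
      Finset.univ_unique, Finset.sum_const, Finset.card_singleton, one_smul] at h1 ⊢
    linarith

end WordSums

/-! ### Word shifts on the Fock space -/

section Fock

variable {n : ℕ}

theorem inner_fockBasis_left (α : Word n) (x : Fock n) : ⟪fockBasis α, x⟫_ℂ = x α := by
  simp [fockBasis, lp.inner_single_left]

theorem fockBasis_apply (α β : Word n) :
    (fockBasis α : Fock n) β = if β = α then 1 else 0 := by
  rw [fockBasis, lp.single_apply]
  by_cases h : β = α
  · subst h; simp
  · simp [h]

theorem hasSum_fockBasis (x : Fock n) : HasSum (fun α => x α • fockBasis α) x := by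
  have h : (fun α => x α • (fockBasis α : Fock n)) = fun α => lp.single 2 α (x α) := by
    funext α
    rw [fockBasis, ← lp.single_smul, smul_eq_mul, mul_one]
  rw [h]
  exact lp.hasSum_single (by simp) x

theorem ext_fockBasis {F : Type*} [NormedAddCommGroup F] [NormedSpace ℂ F]
    {A B : Fock n →L[ℂ] F} (h : ∀ α, A (fockBasis α) = B (fockBasis α)) : A = B := by
  ext x
  have hA := A.hasSum (hasSum_fockBasis x)
  have hB := B.hasSum (hasSum_fockBasis x)
  simp only [map_smul, h] at hA hB
  exact hA.unique hB

theorem fock_norm_sq (x : Fock n) : HasSum (fun α => ‖x α‖ ^ 2) (‖x‖ ^ 2) := by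
  have := lp.hasSum_norm (p := 2) (by simp) x
  simpa using this

/-- The isometry `e_α ↦ e_{c α}` of the Fock space defined by an injective map `c` of words. -/
def wordShift (c : Word n → Word n) (hc : Function.Injective c) : Fock n →L[ℂ] Fock n :=
  ((orthonormal_fockBasis (n := n)).comp c hc).orthogonalFamily.linearIsometry.toContinuousLinearMap

theorem wordShift_fockBasis (c : Word n → Word n) (hc : Function.Injective c) (α : Word n) :
    wordShift c hc (fockBasis α) = fockBasis (c α) := by
  simp [wordShift, fockBasis]

theorem adjoint_wordShift_apply (c : Word n → Word n) (hc : Function.Injective c) (x : Fock n)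
    (α : Word n) : (wordShift c hc).adjoint x α = x (c α) := by
  rw [← inner_fockBasis_left, ContinuousLinearMap.adjoint_inner_right, wordShift_fockBasis,
    inner_fockBasis_left]

/-- If every nonempty word is uniquely of the form `c i α`, then the shifts by `c 1, …, c n` have
orthogonal ranges, whose sum is the orthogonal complement of the vacuum vector. -/
theorem norm_sq_eq_vacuum_add {c : Fin n → Word n → Word n}
    (hc : Function.Bijective fun o : Option (Fin n × Word n) => o.elim [] fun p => c p.1 p.2)
    (hci : ∀ i, Function.Injective (c i)) (x : Fock n) :
    ‖x‖ ^ 2 = ‖x []‖ ^ 2 + ∑ i, ‖(wordShift (c i) (hci i)).adjoint x‖ ^ 2 := by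
  have h1 := ((Equiv.ofBijective _ hc).hasSum_iff).2 (fock_norm_sq x)
  have h2 : HasSum (fun p : Fin n × Word n => ‖x (c p.1 p.2)‖ ^ 2)
      (∑ i, ‖(wordShift (c i) (hci i)).adjoint x‖ ^ 2) := by
    have h3 : Summable fun p : Fin n × Word n => ‖x (c p.1 p.2)‖ ^ 2 :=
      h1.summable.comp_injective (i := some) (Option.some_injective _)
    refine (h3.hasSum.prod_fiberwise fun i => ?_).unique (hasSum_fintype _) ▸ h3.hasSum
    simpa only [adjoint_wordShift_apply] using
      fock_norm_sq ((wordShift (c i) (hci i)).adjoint x)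
  have h4 : HasSum ((fun α => ‖x α‖ ^ 2) ∘ (Equiv.ofBijective _ hc))
      (‖x []‖ ^ 2 + ∑ i, ‖(wordShift (c i) (hci i)).adjoint x‖ ^ 2) := by
    have h3 : HasSum (fun o : Option (Fin n × Word n) => o.elim 0 fun p => ‖x (c p.1 p.2)‖ ^ 2)
        (∑ i, ‖(wordShift (c i) (hci i)).adjoint x‖ ^ 2) := by
      refine ((Option.some_injective (Fin n × Word n)).hasSum_iff ?_).1 h2
      rintro (_ | p) hp
      · rfl
      · exact absurd ⟨p, rfl⟩ hp
    have h5 := (hasSum_ite_eq (none : Option (Fin n × Word n)) (‖x []‖ ^ 2)).add h3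
    convert h5 using 1
    funext o
    rcases o with _ | p <;> simp
  exact h1.unique h4

/-- The right creation operator `e_α ↦ e_{α β}`. -/
def rightCreation (β : Word n) : Fock n →L[ℂ] Fock n :=
  wordShift (fun α => α ++ β) (List.append_left_injective β)

theorem rightCreation_fockBasis (α β : Word n) :
    rightCreation β (fockBasis α) = fockBasis (α ++ β) :=
  wordShift_fockBasis _ _ _

theorem adjoint_rightCreation_apply (β : Word n) (x : Fock n) (α : Word n) :
    (rightCreation β).adjoint x α = x (α ++ β) :=
  adjoint_wordShift_apply _ _ _ _

theorem norm_sq_eq_right (x : Fock n) :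
    ‖x‖ ^ 2 = ‖x []‖ ^ 2 + ∑ i, ‖(rightCreation [i]).adjoint x‖ ^ 2 := by
  refine norm_sq_eq_vacuum_add (c := fun i α => α ++ [i]) ⟨?_, ?_⟩ _ x
  · rintro (_ | ⟨i, α⟩) (_ | ⟨j, β⟩) h <;> simp_all
  · intro γ
    rcases List.eq_nil_or_concat' γ with rfl | ⟨α, i, rfl⟩
    · exact ⟨none, rfl⟩
    · exact ⟨some (i, α), rfl⟩

theorem norm_sq_eq_left (x : Fock n) :
    ‖x‖ ^ 2 = ‖x []‖ ^ 2 + ∑ i, ‖(leftCreation i).adjoint x‖ ^ 2 := by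
  refine norm_sq_eq_vacuum_add (c := fun i α => i :: α) ⟨?_, ?_⟩
    (fun _ => List.cons_injective) x
  · rintro (_ | ⟨i, α⟩) (_ | ⟨j, β⟩) h <;> simp_all
  · rintro (_ | ⟨i, α⟩)
    · exact ⟨none, rfl⟩
    · exact ⟨some (i, α), rfl⟩

theorem isRowContraction_of_norm_sq {E : Type*} [NormedAddCommGroup E] [InnerProductSpace ℂ E]
    [CompleteSpace E] {T : Fin n → E →L[ℂ] E}
    (h : ∀ x, ∑ i, ‖(T i).adjoint x‖ ^ 2 ≤ ‖x‖ ^ 2) : IsRowContraction T := by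
  refine (ContinuousLinearMap.isPositive_iff_complex _).2 fun x => ?_
  have key : ⟪(1 - ∑ i, T i ∘L (T i).adjoint) x, x⟫_ℂ
      = ((‖x‖ ^ 2 - ∑ i, ‖(T i).adjoint x‖ ^ 2 : ℝ) : ℂ) := by
    have h1 : (1 - ∑ i, T i ∘L (T i).adjoint) x = x - ∑ i, T i ((T i).adjoint x) := by
      simp
    rw [h1, inner_sub_left, sum_inner]
    push_cast
    congr 1
    · exact inner_self_eq_norm_sq_to_K (𝕜 := ℂ) x
    · refine Finset.sum_congr rfl fun i _ => ?_
      rw [← ContinuousLinearMap.adjoint_inner_right]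
      exact inner_self_eq_norm_sq_to_K (𝕜 := ℂ) _
  rw [key]
  exact ⟨by rw [RCLike.re_eq_complex_re, Complex.ofReal_re], by
    rw [RCLike.re_eq_complex_re, Complex.ofReal_re]; exact sub_nonneg.2 (h x)⟩

theorem isRowContraction_leftCreation : IsRowContraction (leftCreation (n := n)) :=
  isRowContraction_of_norm_sq fun x => by
    rw [norm_sq_eq_left x]
    exact le_add_of_nonneg_left (by positivity)

end Fock

/-! ### Strong limits of bounded families of operators -/

section StrongLimits

variable {ι E F : Type*} [NormedAddCommGroup E] [NormedSpace ℂ E] [NormedAddCommGroup F]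
  [NormedSpace ℂ F] {l : Filter ι}

theorem exists_tendsto_of_dense [CompleteSpace F] [l.NeBot] {A : ι → E →L[ℂ] F} {C : ℝ}
    (hC : ∀ᶠ i in l, ‖A i‖ ≤ C) {s : Set E} (hs : Dense s)
    (h : ∀ x ∈ s, ∃ y, Tendsto (fun i => A i x) l (𝓝 y)) :
    ∃ B : E →L[ℂ] F, ‖B‖ ≤ C ∧ ∀ x, Tendsto (fun i => A i x) l (𝓝 (B x)) := by
  have hC0 : 0 ≤ C := by
    obtain ⟨i, hi⟩ := hC.exists
    exact (norm_nonneg _).trans hi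
  have key : ∀ x, ∃ y, Tendsto (fun i => A i x) l (𝓝 y) := by
    intro x
    refine CompleteSpace.complete (f := map (fun i => A i x) l) ?_
    rw [Metric.cauchy_iff]
    refine ⟨inferInstance, fun ε hε => ?_⟩
    obtain ⟨x', hx', hxx'⟩ := Metric.dense_iff.1 hs x (ε / (4 * (C + 1))) (by positivity)
    rw [Metric.mem_ball, dist_comm, dist_eq_norm, lt_div_iff₀ (by positivity)] at hx'
    obtain ⟨y, hy⟩ := h x' hxx'
    have hy' := Metric.tendsto_nhds.1 hy (ε / 4) (by positivity)
    refine ⟨Metric.ball y (ε / 2), mem_map.2 ?_, ?_⟩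
    · filter_upwards [hC, hy'] with i hi hi'
      rw [dist_eq_norm] at hi'
      rw [Set.mem_preimage, Metric.mem_ball, dist_eq_norm]
      have h1 : ‖A i (x - x')‖ ≤ C * ‖x - x'‖ := (A i).le_of_opNorm_le hi _
      have h2 : A i x - y = A i (x - x') + (A i x' - y) := by rw [map_sub]; abel
      rw [h2]
      refine (norm_add_le _ _).trans_lt ?_
      nlinarith [norm_nonneg (x - x')]
    · intro u hu v hv
      have := dist_triangle_right u v y
      rw [Metric.mem_ball] at hu hv
      linarith
  choose g hg using key
  refine ⟨LinearMap.mkContinuous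
    { toFun := g
      map_add' := fun x y => tendsto_nhds_unique (hg _) (by simpa using (hg x).add (hg y))
      map_smul' := fun c x => tendsto_nhds_unique (hg _) (by simpa using (hg x).const_smul c) }
    C fun x => ?_, LinearMap.mkContinuous_norm_le _ hC0 _, fun x => hg x⟩
  refine le_of_tendsto (hg x).norm ?_
  filter_upwards [hC] with i hi
  exact (A i).le_of_opNorm_le hi x

theorem tendsto_apply_of_dense_span [CompleteSpace F] [l.NeBot] {A : ι → E →L[ℂ] F}
    {B : E →L[ℂ] F} {C : ℝ} (hC : ∀ᶠ i in l, ‖A i‖ ≤ C) {s : Set E}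
    (hs : (Submodule.span ℂ s).topologicalClosure = ⊤)
    (h : ∀ x ∈ s, Tendsto (fun i => A i x) l (𝓝 (B x))) (x : E) :
    Tendsto (fun i => A i x) l (𝓝 (B x)) := by
  have h1 : ∀ x ∈ Submodule.span ℂ s, Tendsto (fun i => A i x) l (𝓝 (B x)) := by
    intro x hx
    induction hx using Submodule.span_induction with
    | mem x hx => exact h x hx
    | zero => simp
    | add x y _ _ hx hy => simpa using hx.add hy
    | smul c x _ hx => simpa using hx.const_smul c
  have hd : Dense (Submodule.span ℂ s : Set E) :=
    (Submodule.dense_iff_topologicalClosure_eq_top).2 hs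
  obtain ⟨B', -, hB'⟩ := exists_tendsto_of_dense hC hd fun x hx => ⟨_, h1 x hx⟩
  have : B' = B := ContinuousLinearMap.ext_on hd fun x hx => tendsto_nhds_unique (hB' x) (h x hx)
  exact this ▸ hB' x

end StrongLimits

section Fock

variable {n : ℕ}

theorem span_fockBasis :
    (Submodule.span ℂ (Set.range (fockBasis : Word n → Fock n))).topologicalClosure = ⊤ := by
  refine top_unique fun x _ => ?_
  refine (Submodule.isClosed_topologicalClosure _).mem_of_tendsto (hasSum_fockBasis x)
    (Eventually.of_forall fun s => Submodule.le_topologicalClosure _ ?_)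
  exact Submodule.sum_mem _ fun α _ => Submodule.smul_mem _ _ (Submodule.subset_span ⟨α, rfl⟩)

/-! ### The commutant of the right creation operators -/

variable (n) in
/-- The algebra of all operators on the Fock space that commute with the right creation
operators `e_α ↦ e_α ⊗ e_i`. -/
def rightCommutant : Subalgebra ℂ (Fock n →L[ℂ] Fock n) :=
  Subalgebra.centralizer ℂ (Set.range fun i : Fin n => rightCreation [i])

theorem mem_rightCommutant_iff {f : Fock n →L[ℂ] Fock n} :
    f ∈ rightCommutant n ↔ ∀ i x, f (rightCreation [i] x) = rightCreation [i] (f x) := by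
  simp only [rightCommutant, Subalgebra.mem_centralizer_iff, Set.forall_mem_range]
  refine forall_congr' fun i => ⟨fun h x => (DFunLike.congr_fun h x).symm, fun h => ?_⟩
  ext1 x
  exact (h x).symm

theorem rightCreation_nil : rightCreation ([] : Word n) = 1 :=
  ext_fockBasis fun α => by simp [rightCreation_fockBasis]

theorem rightCreation_cons (i : Fin n) (β : Word n) :
    rightCreation (i :: β) = rightCreation β ∘L rightCreation [i] :=
  ext_fockBasis fun α => by simp [rightCreation_fockBasis]

theorem apply_rightCreation {f : Fock n →L[ℂ] Fock n} (hf : f ∈ rightCommutant n) (β : Word n)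
    (x : Fock n) : f (rightCreation β x) = rightCreation β (f x) := by
  induction β generalizing x with
  | nil => simp [rightCreation_nil]
  | cons i β ih =>
    simp only [rightCreation_cons i β, ContinuousLinearMap.comp_apply]
    rw [ih, mem_rightCommutant_iff.1 hf]

theorem apply_fockBasis {f : Fock n →L[ℂ] Fock n} (hf : f ∈ rightCommutant n) (β : Word n) :
    f (fockBasis β) = rightCreation β (f (fockBasis [])) := by
  rw [← apply_rightCreation hf, rightCreation_fockBasis, List.nil_append]

theorem leftCreation_mem_rightCommutant (i : Fin n) : leftCreation i ∈ rightCommutant n := by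
  refine mem_rightCommutant_iff.2 fun j x => ?_
  have : leftCreation i ∘L rightCreation [j] = rightCreation [j] ∘L leftCreation i :=
    ext_fockBasis fun α => by simp [rightCreation_fockBasis, leftCreation_fockBasis]
  exact DFunLike.congr_fun this x

theorem mem_centralizer_iff_inner {E : Type*} [NormedAddCommGroup E] [InnerProductSpace ℂ E]
    [CompleteSpace E] {s : Set (E →L[ℂ] E)} {A : E →L[ℂ] E} :
    A ∈ Subalgebra.centralizer ℂ s
      ↔ ∀ C ∈ s, ∀ x y, ⟪C.adjoint y, A x⟫_ℂ = ⟪y, A (C x)⟫_ℂ := by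
  simp only [Subalgebra.mem_centralizer_iff, ContinuousLinearMap.adjoint_inner_left]
  refine forall₂_congr fun C _ => ⟨fun h x y => ?_, fun h => ?_⟩
  · exact congrArg (fun z => ⟪y, z⟫_ℂ) (DFunLike.congr_fun h x)
  · ext1 x
    exact ext_inner_left ℂ fun y => h x y

theorem isWOTClosed_centralizer {E : Type*} [NormedAddCommGroup E] [InnerProductSpace ℂ E]
    [CompleteSpace E] (s : Set (E →L[ℂ] E)) :
    IsWOTClosed (Subalgebra.centralizer ℂ s : Set (E →L[ℂ] E)) := by
  have : (fun A : E →WOT[ℂ] E => A.toCLM) ⁻¹' (Subalgebra.centralizer ℂ s : Set (E →L[ℂ] E))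
      = ⋂ (C ∈ s) (x : E) (y : E), {A | ⟪C.adjoint y, A x⟫_ℂ = ⟪y, A (C x)⟫_ℂ} := by
    ext A
    simp only [Set.mem_preimage, SetLike.mem_coe, mem_centralizer_iff_inner, Set.mem_iInter,
      Set.mem_ofPred_eq]
    rfl
  rw [IsWOTClosed, this]
  refine isClosed_iInter fun C => isClosed_iInter fun _ => isClosed_iInter fun x =>
    isClosed_iInter fun y => isClosed_eq ?_ ?_
  · exact ContinuousLinearMapWOT.continuous_dual_apply x (innerSL ℂ (C.adjoint y))
  · exact ContinuousLinearMapWOT.continuous_dual_apply (C x) (innerSL ℂ y)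

theorem toeplitzAlgebra_le_rightCommutant : toeplitzAlgebra n ≤ rightCommutant n :=
  sInf_le ⟨isWOTClosed_centralizer _, leftCreation_mem_rightCommutant⟩

theorem leftCreation_mem_toeplitzAlgebra (i : Fin n) : leftCreation i ∈ toeplitzAlgebra n :=
  Algebra.mem_sInf.2 fun _ h => h.2 i

theorem mem_toeplitzAlgebra_of_tendsto {ι : Type*} {l : Filter ι} [l.NeBot]
    {A : ι → Fock n →L[ℂ] Fock n} {B : Fock n →L[ℂ] Fock n}
    (hA : ∀ᶠ i in l, A i ∈ toeplitzAlgebra n)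
    (h : ∀ x, Tendsto (fun i => A i x) l (𝓝 (B x))) : B ∈ toeplitzAlgebra n := by
  refine Algebra.mem_sInf.2 fun 𝒜 h𝒜 => ?_
  have h1 : Tendsto (fun i => ContinuousLinearMapWOT.ofCLM (A i)) l
      (𝓝 (ContinuousLinearMapWOT.ofCLM B)) := by
    rw [ContinuousLinearMapWOT.tendsto_iff_forall_dual_apply_tendsto]
    exact fun x y => (y.continuous.tendsto _).comp (h x)
  refine h𝒜.1.mem_of_tendsto h1 ?_
  filter_upwards [hA] with i hi
  exact Algebra.mem_sInf.1 hi 𝒜 h𝒜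

end Fock

/-! ### Tensor products -/

section Tensor

variable {E F E' F' : Type*}
  [NormedAddCommGroup E] [InnerProductSpace ℂ E] [NormedAddCommGroup F] [InnerProductSpace ℂ F]
  [NormedAddCommGroup E'] [InnerProductSpace ℂ E'] [NormedAddCommGroup F']
  [InnerProductSpace ℂ F']

theorem norm_tensor (x : E) (y : F) : ‖tensor x y‖ = ‖x‖ * ‖y‖ := by
  rw [tensor, UniformSpace.Completion.norm_coe, TensorProduct.norm_tmul]

variable (E) in
/-- The bounded operator `x ↦ x ⊗ y`. -/
def tensorRight (y : F) : E →L[ℂ] HilbertTensor E F :=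
  LinearMap.mkContinuous
    { toFun := fun x => tensor x y
      map_add' := fun x x' => by
        rw [tensor, TensorProduct.add_tmul, UniformSpace.Completion.coe_add]; rfl
      map_smul' := fun c x => by
        rw [tensor, ← TensorProduct.smul_tmul', UniformSpace.Completion.coe_smul]; rfl }
    ‖y‖ fun x => (by rw [mul_comm]; exact (norm_tensor x y).le)

theorem tensorRight_apply (x : E) (y : F) : tensorRight E y x = tensor x y := rfl

theorem ext_tensor {G : Type*} [NormedAddCommGroup G] [NormedSpace ℂ G]
    {A B : HilbertTensor E F →L[ℂ] G} (h : ∀ x y, A (tensor x y) = B (tensor x y)) : A = B := by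
  ext t
  induction t using UniformSpace.Completion.induction_on with
  | hp => exact isClosed_eq A.continuous B.continuous
  | ih t =>
    induction t using TensorProduct.induction_on with
    | zero => rw [UniformSpace.Completion.coe_zero, map_zero, map_zero]
    | tmul x y => exact h x y
    | add s t hs ht => rw [UniformSpace.Completion.coe_add, map_add, map_add, hs, ht]

theorem norm_tensorOp_le (A : E →L[ℂ] E') (C : F →L[ℂ] F') : ‖tensorOp A C‖ ≤ ‖A‖ * ‖C‖ := by
  refine ContinuousLinearMap.opNorm_le_bound _ (by positivity) fun t => ?_
  induction t using UniformSpace.Completion.induction_on with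
  | hp => exact isClosed_le (tensorOp A C).continuous.norm (by fun_prop)
  | ih t =>
    rw [tensorOp, ContinuousLinearMap.completion_apply_coe, UniformSpace.Completion.norm_coe,
      UniformSpace.Completion.norm_coe]
    exact ContinuousLinearMap.le_of_opNorm_le _ (TensorProduct.norm_mapL_le A C) t

theorem ext_inner_tensor {s t : HilbertTensor E F}
    (h : ∀ x y, ⟪tensor x y, s⟫_ℂ = ⟪tensor x y, t⟫_ℂ) : s = t := by
  have : innerSL ℂ s = innerSL ℂ t := ext_tensor fun x y => by
    simp only [innerSL_apply_apply]
    rw [← inner_conj_symm, h, inner_conj_symm]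
  exact ext_inner_right ℂ fun v => DFunLike.congr_fun this v

theorem inner_tensor_tensor (x x' : E) (y y' : F) :
    ⟪tensor x y, tensor x' y'⟫_ℂ = ⟪x, x'⟫_ℂ * ⟪y, y'⟫_ℂ := by
  rw [tensor, tensor, UniformSpace.Completion.inner_coe, TensorProduct.inner_tmul]

theorem inner_tensor_tensorOp [CompleteSpace E] [CompleteSpace E'] (A : E →L[ℂ] E') (x : E')
    (y : F) (t : HilbertTensor E F) :
    ⟪tensor x y, tensorOp A (ContinuousLinearMap.id ℂ F) t⟫_ℂ = ⟪tensor (A.adjoint x) y, t⟫_ℂ := by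
  have : innerSL ℂ (tensor x y) ∘L tensorOp A (ContinuousLinearMap.id ℂ F)
      = innerSL ℂ (tensor (A.adjoint x) y) := ext_tensor fun x' y' => by
    simp only [ContinuousLinearMap.comp_apply, innerSL_apply_apply, tensorOp_tensor,
      inner_tensor_tensor, ContinuousLinearMap.adjoint_inner_left, ContinuousLinearMap.id_apply]
  exact DFunLike.congr_fun this t

end Tensor

/-! ### Row contractions -/

section Row

variable {n : ℕ} {E : Type*} [NormedAddCommGroup E] [InnerProductSpace ℂ E]

theorem wordOp_append (T : Fin n → E →L[ℂ] E) (α β : Word n) :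
    wordOp T (α ++ β) = wordOp T α ∘L wordOp T β := by
  simp [wordOp, ContinuousLinearMap.mul_def]

theorem wordOp_singleton (T : Fin n → E →L[ℂ] E) (i : Fin n) : wordOp T [i] = T i := by
  simp [wordOp]

theorem wordOp_smul (T : Fin n → E →L[ℂ] E) (c : ℂ) (α : Word n) :
    wordOp (fun i => c • T i) α = c ^ α.length • wordOp T α := by
  induction α with
  | nil => simp [wordOp]
  | cons i α ih =>
    simp only [wordOp, List.map_cons, List.prod_cons, List.length_cons] at *
    rw [ih, smul_mul_smul_comm, pow_succ']

/-- The homogeneous part `∑_{|α| = k} r^k x_α T_α` of the power series with coefficient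
sequence `x ∈ ℓ²`. -/
def seriesPart (x : Fock n) (T : Fin n → E →L[ℂ] E) (r : ℝ) (k : ℕ) : E →L[ℂ] E :=
  ∑ w : Fin k → Fin n, ((r : ℂ) ^ k * x (List.ofFn w)) • wordOp T (List.ofFn w)

theorem homogeneousPart_eq (f : toeplitzAlgebra n) (T : Fin n → E →L[ℂ] E) (r : ℝ) :
    homogeneousPart f T r = seriesPart (f.1 (fockBasis [])) T r := rfl

theorem seriesPart_smul (x : Fock n) (T : Fin n → E →L[ℂ] E) (r : ℝ) (k : ℕ) :
    seriesPart x (fun i => (r : ℂ) • T i) 1 k = seriesPart x T r k := by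
  refine Finset.sum_congr rfl fun w _ => ?_
  rw [wordOp_smul, List.length_ofFn, smul_smul]
  congr 1
  push_cast
  ring

variable [CompleteSpace E]

theorem IsRowContraction.sum_norm_adjoint_sq_le {T : Fin n → E →L[ℂ] E} (hT : IsRowContraction T)
    (h : E) : ∑ i, ‖(T i).adjoint h‖ ^ 2 ≤ ‖h‖ ^ 2 := by
  have := norm_defect_sq hT h
  nlinarith [sq_nonneg ‖defectMap T h‖]

theorem adjoint_wordOp_append (T : Fin n → E →L[ℂ] E) (α β : Word n) (h : E) :
    (wordOp T (α ++ β)).adjoint h = (wordOp T β).adjoint ((wordOp T α).adjoint h) := by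
  rw [wordOp_append, ContinuousLinearMap.adjoint_comp, ContinuousLinearMap.comp_apply]

theorem adjoint_wordOp_nil (T : Fin n → E →L[ℂ] E) (h : E) : (wordOp T []).adjoint h = h := by
  have h1 : (1 : E →L[ℂ] E).adjoint = 1 := star_one (E →L[ℂ] E)
  simp [wordOp, h1]

theorem IsRowContraction.sum_words_norm_adjoint_sq_le {T : Fin n → E →L[ℂ] E}
    (hT : IsRowContraction T) (k : ℕ) (h : E) :
    ∑ w : Fin k → Fin n, ‖(wordOp T (List.ofFn w)).adjoint h‖ ^ 2 ≤ ‖h‖ ^ 2 := by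
  induction k with
  | zero => simp [adjoint_wordOp_nil]
  | succ k ih =>
    rw [sum_words_succ fun α => ‖(wordOp T α).adjoint h‖ ^ 2, Finset.sum_comm]
    refine (Finset.sum_le_sum fun w _ => ?_).trans ih
    simp only [adjoint_wordOp_append, wordOp_singleton]
    exact hT.sum_norm_adjoint_sq_le _

theorem IsRowContraction.smul {T : Fin n → E →L[ℂ] E} (hT : IsRowContraction T) {r : ℝ}
    (hr : r ∈ Set.Icc (0 : ℝ) 1) : IsRowContraction fun i => (r : ℂ) • T i := by
  refine isRowContraction_of_norm_sq fun x => ?_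
  refine le_trans (Finset.sum_le_sum fun i _ => ?_) (hT.sum_norm_adjoint_sq_le x)
  rw [map_smulₛₗ, smul_apply, norm_smul, mul_pow]
  refine mul_le_of_le_one_left (by positivity) ?_
  simpa using pow_le_one₀ (n := 2) hr.1 hr.2

theorem fock_sum_words_le (x : Fock n) (k : ℕ) :
    ∑ w : Fin k → Fin n, ‖x (List.ofFn w)‖ ^ 2 ≤ ‖x‖ ^ 2 :=
  le_hasSum (hasSum_levels (fock_norm_sq x)) k fun _ _ => Finset.sum_nonneg fun _ _ => by positivity

/-- A homogeneous polynomial of degree `k` in a row contraction is bounded by the `ℓ²`-norm of its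
coefficients, because `[T_α]_{|α| = k}` is again a row contraction. -/
theorem norm_seriesPart_le {T : Fin n → E →L[ℂ] E} (hT : IsRowContraction T) (x : Fock n) {r : ℝ}
    (hr : 0 ≤ r) (k : ℕ) : ‖seriesPart x T r k‖ ≤ r ^ k * ‖x‖ := by
  rw [← ContinuousLinearMap.adjoint.norm_map]
  refine ContinuousLinearMap.opNorm_le_bound _ (by positivity) fun h => ?_
  have h1 : (seriesPart x T r k).adjoint h = ∑ w : Fin k → Fin n,
      (starRingEnd ℂ ((r : ℂ) ^ k * x (List.ofFn w))) • (wordOp T (List.ofFn w)).adjoint h := by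
    simp only [seriesPart, map_sum, map_smulₛₗ, sum_apply, smul_apply]
  rw [h1]
  calc _ ≤ ∑ w : Fin k → Fin n,
        r ^ k * (‖x (List.ofFn w)‖ * ‖(wordOp T (List.ofFn w)).adjoint h‖) := by
        refine (norm_sum_le _ _).trans (Finset.sum_le_sum fun w _ => ?_)
        rw [norm_smul, RCLike.norm_conj, norm_mul, norm_pow, Complex.norm_real,
          Real.norm_of_nonneg hr, mul_assoc]
    _ ≤ r ^ k * (‖x‖ * ‖h‖) := by
        rw [← Finset.mul_sum]
        refine mul_le_mul_of_nonneg_left ?_ (by positivity)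
        refine (Real.sum_mul_le_sqrt_mul_sqrt _ _ _).trans ?_
        refine mul_le_mul ?_ ?_ (Real.sqrt_nonneg _) (norm_nonneg _)
        · exact Real.sqrt_le_iff.2 ⟨norm_nonneg _, fock_sum_words_le x k⟩
        · exact Real.sqrt_le_iff.2 ⟨norm_nonneg _, hT.sum_words_norm_adjoint_sq_le k h⟩
    _ = r ^ k * ‖x‖ * ‖h‖ := (mul_assoc _ _ _).symm

theorem summable_seriesPart {T : Fin n → E →L[ℂ] E} (hT : IsRowContraction T) (x : Fock n) {r : ℝ}
    (hr : r ∈ Set.Ioo (0 : ℝ) 1) : Summable (seriesPart x T r) :=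
  .of_norm_bounded ((summable_geometric_of_lt_one hr.1.le hr.2).mul_right ‖x‖)
    fun k => norm_seriesPart_le hT x hr.1.le k

end Row

/-! ### The Poisson kernel and the von Neumann inequality -/

section Poisson

variable {n : ℕ} {H : Type*} [NormedAddCommGroup H] [InnerProductSpace ℂ H] [CompleteSpace H]
  {T : Fin n → H →L[ℂ] H}

instance : CompleteSpace (defectSpace T) :=
  (Submodule.isClosed_topologicalClosure _).completeSpace_coe

theorem hasSum_poissonKernel (hT : IsRowContraction T) (h : H) :
    HasSum (fun α : Word n => tensor (fockBasis α : Fock n) (poissonCoeff T α h))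
      (poissonKernel T hT h) :=
  (poisson_summable hT h).hasSum

theorem norm_poissonKernel_le (hT : IsRowContraction T) : ‖poissonKernel T hT‖ ≤ 1 :=
  LinearMap.mkContinuous_norm_le _ zero_le_one _

theorem inner_fockTensor_poissonKernel (hT : IsRowContraction T) (α : Word n)
    (y : defectSpace T) (h : H) :
    ⟪tensor (fockBasis α : Fock n) y, poissonKernel T hT h⟫_ℂ = ⟪y, poissonCoeff T α h⟫_ℂ := by
  have h1 := (innerSL ℂ (tensor (fockBasis α : Fock n) y)).hasSum (hasSum_poissonKernel hT h)
  have h2 : ∀ β, β ≠ α → innerSL ℂ (tensor (fockBasis α : Fock n) y)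
      (tensor (fockBasis β : Fock n) (poissonCoeff T β h)) = 0 := fun β hβ => by
    rw [innerSL_apply_apply, inner_tensor_tensor, orthonormal_fockBasis.2 hβ.symm, zero_mul]
  refine (h1.unique (hasSum_single α h2)).trans ?_
  rw [innerSL_apply_apply, inner_tensor_tensor, inner_self_eq_norm_sq_to_K,
    orthonormal_fockBasis.1]
  simp

theorem adjoint_poissonKernel_fockTensor (hT : IsRowContraction T) (α : Word n)
    (y : defectSpace T) :
    (poissonKernel T hT).adjoint (tensor (fockBasis α : Fock n) y)
      = (poissonCoeff T α).adjoint y := by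
  refine ext_inner_right ℂ fun h => ?_
  rw [ContinuousLinearMap.adjoint_inner_left, inner_fockTensor_poissonKernel,
    ContinuousLinearMap.adjoint_inner_left]

theorem hasSum_norm_poissonKernel (hT : IsRowContraction T) (h : H) :
    HasSum (fun α => ‖poissonCoeff T α h‖ ^ 2) (‖poissonKernel T hT h‖ ^ 2) := by
  have h1 := (innerSL ℂ (poissonKernel T hT h)).hasSum (hasSum_poissonKernel hT h)
  have h2 : ∀ α, innerSL ℂ (poissonKernel T hT h) (tensor (fockBasis α) (poissonCoeff T α h))
      = ((‖poissonCoeff T α h‖ ^ 2 : ℝ) : ℂ) := fun α => by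
    rw [innerSL_apply_apply, ← inner_conj_symm, inner_fockTensor_poissonKernel, inner_conj_symm,
      inner_self_eq_norm_sq_to_K]
    push_cast
    rfl
  have h3 : innerSL ℂ (poissonKernel T hT h) (poissonKernel T hT h)
      = ((‖poissonKernel T hT h‖ ^ 2 : ℝ) : ℂ) := by
    rw [innerSL_apply_apply, inner_self_eq_norm_sq_to_K]
    push_cast
    rfl
  rw [funext h2, h3] at h1
  exact Complex.hasSum_ofReal.1 h1

theorem sum_range_norm_poissonCoeff_sq (hT : IsRowContraction T) (h : H) (m : ℕ) :
    ∑ k ∈ Finset.range m, ∑ w : Fin k → Fin n, ‖poissonCoeff T (List.ofFn w) h‖ ^ 2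
      = ‖h‖ ^ 2 - ∑ w : Fin m → Fin n, ‖(wordOp T (List.ofFn w)).adjoint h‖ ^ 2 := by
  induction m with
  | zero => simp [adjoint_wordOp_nil]
  | succ m ih =>
    rw [Finset.sum_range_succ, ih, sum_words_succ fun α => ‖(wordOp T α).adjoint h‖ ^ 2,
      Finset.sum_comm]
    have : ∀ w : Fin m → Fin n, ‖poissonCoeff T (List.ofFn w) h‖ ^ 2
        = ‖(wordOp T (List.ofFn w)).adjoint h‖ ^ 2
          - ∑ i, ‖(wordOp T (List.ofFn w ++ [i])).adjoint h‖ ^ 2 := fun w => by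
      simp only [adjoint_wordOp_append, wordOp_singleton]
      exact norm_defect_sq hT _
    simp only [this, Finset.sum_sub_distrib]
    ring

theorem tendsto_norm_poissonKernel (hT : IsRowContraction T) (h : H) :
    Tendsto (fun m => ‖h‖ ^ 2 - ∑ w : Fin m → Fin n, ‖(wordOp T (List.ofFn w)).adjoint h‖ ^ 2)
      atTop (𝓝 (‖poissonKernel T hT h‖ ^ 2)) := by
  have := (hasSum_levels (hasSum_norm_poissonKernel hT h)).tendsto_sum_nat
  simpa only [sum_range_norm_poissonCoeff_sq hT] using this

/-- If `K_T h = 0`, the energy balance gives `∑_{|α| = k} ‖T_α^* h‖² = ‖h‖²` for every `k`. -/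
theorem ker_poissonKernel (hT : IsRowContraction T) (hT_cnc : IsCompletelyNonCoisometric T)
    {h : H} (hh : poissonKernel T hT h = 0) : h = 0 := by
  by_contra hne
  refine hT_cnc ⟨h, hne, fun k _ => ?_⟩
  have h1 := hasSum_norm_poissonKernel hT h
  rw [hh, norm_zero, zero_pow two_ne_zero,
    hasSum_zero_iff_of_nonneg fun α => by positivity] at h1
  have h2 := sum_range_norm_poissonCoeff_sq hT h k
  rw [Finset.sum_eq_zero fun k _ => Finset.sum_eq_zero fun w _ => congrFun h1 (List.ofFn w)] at h2
  linarith

theorem dense_range_adjoint_poissonKernel (hT : IsRowContraction T)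
    (hT_cnc : IsCompletelyNonCoisometric T) :
    (Submodule.span ℂ (Set.range fun p : Fock n × defectSpace T =>
      (poissonKernel T hT).adjoint (tensor p.1 p.2))).topologicalClosure = ⊤ := by
  rw [Submodule.topologicalClosure_eq_top_iff, Submodule.eq_bot_iff]
  intro h hh
  refine ker_poissonKernel hT hT_cnc (ext_inner_tensor fun x y => ?_)
  rw [inner_zero_right, ← ContinuousLinearMap.adjoint_inner_left]
  exact hh _ (Submodule.subset_span ⟨(x, y), rfl⟩)

theorem tendsto_sum_words_smul (hT : IsRowContraction T) {r : ℝ} (hr : r ∈ Set.Ioo (0 : ℝ) 1)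
    (h : H) : Tendsto (fun m => ∑ w : Fin m → Fin n,
      ‖(wordOp (fun i => (r : ℂ) • T i) (List.ofFn w)).adjoint h‖ ^ 2) atTop (𝓝 0) := by
  have h0 : Tendsto (fun m : ℕ => (r ^ 2) ^ m * ‖h‖ ^ 2) atTop (𝓝 0) := by
    have := (tendsto_pow_atTop_nhds_zero_of_lt_one (sq_nonneg r)
      (pow_lt_one₀ hr.1.le hr.2 two_ne_zero)).mul_const (‖h‖ ^ 2)
    rwa [zero_mul] at this
  refine squeeze_zero (fun m => Finset.sum_nonneg fun _ _ => by positivity) (fun m => ?_) h0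
  refine le_trans (le_of_eq ?_)
    (mul_le_mul_of_nonneg_left (hT.sum_words_norm_adjoint_sq_le m h) (by positivity))
  rw [Finset.mul_sum]
  refine Finset.sum_congr rfl fun w _ => ?_
  rw [wordOp_smul, map_smulₛₗ, smul_apply, norm_smul, mul_pow, List.length_ofFn, RCLike.norm_conj,
    norm_pow, Complex.norm_real, Real.norm_of_nonneg hr.1.le]
  ring

/-- The strict row contraction `rT` is pure, so its Poisson kernel is an isometry. -/
theorem norm_poissonKernel_smul (hT : IsRowContraction T) {r : ℝ} (hr : r ∈ Set.Ioo (0 : ℝ) 1)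
    (h : H) : ‖poissonKernel (fun i => (r : ℂ) • T i) (hT.smul ⟨hr.1.le, hr.2.le⟩) h‖ = ‖h‖ := by
  have h1 := tendsto_norm_poissonKernel (hT.smul ⟨hr.1.le, hr.2.le⟩) h
  have h2 := (tendsto_sum_words_smul hT hr h).const_sub (‖h‖ ^ 2)
  rw [sub_zero] at h2
  have h3 := tendsto_nhds_unique h1 h2
  exact (pow_left_inj₀ (norm_nonneg _) (norm_nonneg _) two_ne_zero).1 h3

/-- The intertwining relation `A K_T^* = K_T^* (f ⊗ I)` when `A = ∑_α a_α T_α` is the norm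
convergent value at `T` of an operator `f` with Fourier coefficients `a_α`. -/
theorem apply_adjoint_poissonKernel (hT : IsRowContraction T) {f : Fock n →L[ℂ] Fock n}
    (hf : f ∈ rightCommutant n) {A : H →L[ℂ] H}
    (hA : HasSum (seriesPart (f (fockBasis [])) T 1) A) (x : Fock n) (y : defectSpace T) :
    A ((poissonKernel T hT).adjoint (tensor x y))
      = (poissonKernel T hT).adjoint (tensor (f x) y) := by
  have key : A ∘L (poissonKernel T hT).adjoint ∘L tensorRight (Fock n) y
      = (poissonKernel T hT).adjoint ∘L tensorRight (Fock n) y ∘L f := by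
    refine ext_fockBasis fun β => ?_
    simp only [ContinuousLinearMap.comp_apply, tensorRight_apply, adjoint_poissonKernel_fockTensor]
    rw [apply_fockBasis hf]
    have h1 := ((poissonKernel T hT).adjoint ∘L tensorRight (Fock n) y ∘L
      rightCreation β).hasSum (hasSum_fockBasis (f (fockBasis [])))
    have h2 := (ContinuousLinearMap.apply ℂ H ((poissonCoeff T β).adjoint y)).hasSum hA
    refine h2.unique ?_
    convert hasSum_levels h1 using 1
    · funext k
      simp only [ContinuousLinearMap.apply_apply, seriesPart, sum_apply]
      refine Finset.sum_congr rfl fun w _ => ?_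
      rw [map_smul]
      simp only [ContinuousLinearMap.comp_apply, rightCreation_fockBasis, tensorRight_apply,
        adjoint_poissonKernel_fockTensor, smul_apply, Complex.ofReal_one, one_pow, one_mul]
      congr 1
      simp only [poissonCoeff, ContinuousLinearMap.adjoint_comp, wordOp_append,
        ContinuousLinearMap.adjoint_adjoint, ContinuousLinearMap.comp_apply]
    · rfl
  exact DFunLike.congr_fun key x

/-- Von Neumann's inequality `‖f(rT)‖ ≤ ‖f‖`. -/
theorem norm_tsum_seriesPart_le (hT : IsRowContraction T) {f : Fock n →L[ℂ] Fock n}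
    (hf : f ∈ rightCommutant n) {r : ℝ} (hr : r ∈ Set.Ioo (0 : ℝ) 1) :
    ‖∑' k, seriesPart (f (fockBasis [])) T r k‖ ≤ ‖f‖ := by
  set A := ∑' k, seriesPart (f (fockBasis [])) T r k with hAdef
  have hrT := hT.smul (r := r) ⟨hr.1.le, hr.2.le⟩
  have hA : HasSum (seriesPart (f (fockBasis [])) (fun i => (r : ℂ) • T i) 1) A := by
    simp only [funext (seriesPart_smul (f (fockBasis [])) T r)]
    exact (summable_seriesPart hT _ hr).hasSum
  set K := poissonKernel _ hrT with hK
  have h1 : A ∘L K.adjoint = K.adjoint ∘L tensorOp f (ContinuousLinearMap.id ℂ _) :=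
    ext_tensor fun x y => by
      simp only [ContinuousLinearMap.comp_apply, tensorOp_tensor, ContinuousLinearMap.id_apply]
      exact apply_adjoint_poissonKernel hrT hf hA x y
  have h2 : K.adjoint ∘L K = 1 :=
    (ContinuousLinearMap.norm_map_iff_adjoint_comp_self K).1 (norm_poissonKernel_smul hT hr)
  have h3 : A = K.adjoint ∘L tensorOp f (ContinuousLinearMap.id ℂ _) ∘L K := by
    rw [← ContinuousLinearMap.comp_assoc, ← h1, ContinuousLinearMap.comp_assoc, h2]
    rfl
  have hK1 : ‖K‖ ≤ 1 := norm_poissonKernel_le hrT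
  have hK2 : ‖K.adjoint‖ ≤ 1 := by rwa [ContinuousLinearMap.adjoint.norm_map]
  have hf1 : ‖tensorOp f (ContinuousLinearMap.id ℂ (defectSpace fun i => (r : ℂ) • T i))‖ ≤ ‖f‖ :=
    (norm_tensorOp_le _ _).trans
      (mul_le_of_le_one_right (norm_nonneg _) ContinuousLinearMap.norm_id_le)
  rw [h3]
  calc _ ≤ 1 * (‖f‖ * 1) := (ContinuousLinearMap.opNorm_comp_le _ _).trans
        (mul_le_mul hK2 ((ContinuousLinearMap.opNorm_comp_le _ _).trans
          (mul_le_mul hf1 hK1 (norm_nonneg _) (norm_nonneg _))) (norm_nonneg _) zero_le_one)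
    _ = ‖f‖ := by ring

end Poisson

/-! ### Radial dilations of analytic Toeplitz operators -/

section Dilation

variable {n : ℕ}

theorem eventually_mem_Ioo : ∀ᶠ r : ℝ in 𝓝[<] 1, r ∈ Set.Ioo (0 : ℝ) 1 :=
  Ioo_mem_nhdsLT zero_lt_one

/-- The dilation `f_r = f(rS) = ∑_k ∑_{|α| = k} r^k a_α S_α`. -/
def dilation (f : Fock n →L[ℂ] Fock n) (r : ℝ) : Fock n →L[ℂ] Fock n :=
  ∑' k, seriesPart (f (fockBasis [])) leftCreation r k

theorem norm_dilation_le {f : Fock n →L[ℂ] Fock n} (hf : f ∈ rightCommutant n) {r : ℝ}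
    (hr : r ∈ Set.Ioo (0 : ℝ) 1) : ‖dilation f r‖ ≤ ‖f‖ :=
  norm_tsum_seriesPart_le isRowContraction_leftCreation hf hr

theorem hasSum_dilation (f : Fock n →L[ℂ] Fock n) {r : ℝ} (hr : r ∈ Set.Ioo (0 : ℝ) 1) :
    HasSum (seriesPart (f (fockBasis [])) leftCreation r) (dilation f r) :=
  (summable_seriesPart isRowContraction_leftCreation _ hr).hasSum

theorem dilation_mem_toeplitzAlgebra (f : Fock n →L[ℂ] Fock n) {r : ℝ}
    (hr : r ∈ Set.Ioo (0 : ℝ) 1) : dilation f r ∈ toeplitzAlgebra n := by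
  refine mem_toeplitzAlgebra_of_tendsto (Eventually.of_forall fun s => ?_)
    fun x => ((ContinuousLinearMap.apply ℂ (Fock n) x).continuous.tendsto _).comp
      (hasSum_dilation f hr)
  refine Subalgebra.sum_mem _ fun k _ => Subalgebra.sum_mem _ fun w _ => Subalgebra.smul_mem _ ?_ _
  refine Subalgebra.list_prod_mem _ fun A hA => ?_
  obtain ⟨i, -, rfl⟩ := List.mem_map.1 hA
  exact leftCreation_mem_toeplitzAlgebra i

theorem wordOp_leftCreation_vacuum (α : Word n) :
    wordOp leftCreation α (fockBasis []) = fockBasis α := by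
  induction α with
  | nil => simp [wordOp]
  | cons i α ih =>
    rw [← leftCreation_fockBasis, ← ih]
    simp [wordOp]

theorem seriesPart_leftCreation_vacuum (x : Fock n) (r : ℝ) (k : ℕ) :
    seriesPart x leftCreation r k (fockBasis [])
      = ∑ w : Fin k → Fin n, ((r : ℂ) ^ k * x (List.ofFn w)) • fockBasis (List.ofFn w) := by
  simp only [seriesPart, sum_apply, smul_apply, wordOp_leftCreation_vacuum]

theorem seriesPart_leftCreation_vacuum_apply (x : Fock n) (r : ℝ) (k : ℕ) (γ : Word n) :
    seriesPart x leftCreation r k (fockBasis []) γ = ∑ w : Fin k → Fin n,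
      (r : ℂ) ^ (List.ofFn w).length * x (List.ofFn w) * (fockBasis (List.ofFn w) : Fock n) γ := by
  rw [seriesPart_leftCreation_vacuum, ← inner_fockBasis_left, inner_sum]
  refine Finset.sum_congr rfl fun w _ => ?_
  rw [inner_smul_right, inner_fockBasis_left, List.length_ofFn]

theorem hasSum_seriesPart_leftCreation_vacuum_apply (x : Fock n) (r : ℝ) (γ : Word n) :
    HasSum (fun k => seriesPart x leftCreation r k (fockBasis []) γ)
      ((r : ℂ) ^ γ.length * x γ) := by
  have h1 : ∀ α : Word n, α ≠ γ → (r : ℂ) ^ α.length * x α * (fockBasis α : Fock n) γ = 0 := by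
    intro α hα
    rw [fockBasis_apply, if_neg (Ne.symm hα), mul_zero]
  have h2 := hasSum_levels (hasSum_single γ h1)
  rw [fockBasis_apply, if_pos rfl, mul_one] at h2
  exact h2.congr_fun fun k => seriesPart_leftCreation_vacuum_apply x r k γ

theorem dilation_vacuum_apply (f : Fock n →L[ℂ] Fock n) {r : ℝ} (hr : r ∈ Set.Ioo (0 : ℝ) 1)
    (γ : Word n) : dilation f r (fockBasis []) γ = (r : ℂ) ^ γ.length * f (fockBasis []) γ := by
  have h1 := (innerSL ℂ (fockBasis γ : Fock n)).hasSum
    ((ContinuousLinearMap.apply ℂ (Fock n) (fockBasis [])).hasSum (hasSum_dilation f hr))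
  simp only [innerSL_apply_apply, ContinuousLinearMap.apply_apply, inner_fockBasis_left] at h1
  exact h1.unique (hasSum_seriesPart_leftCreation_vacuum_apply _ r γ)

theorem seriesPart_dilation {E : Type*} [NormedAddCommGroup E] [InnerProductSpace ℂ E]
    (f : Fock n →L[ℂ] Fock n) (T : Fin n → E →L[ℂ] E) {r : ℝ} (hr : r ∈ Set.Ioo (0 : ℝ) 1) :
    seriesPart (dilation f r (fockBasis [])) T 1 = seriesPart (f (fockBasis [])) T r := by
  funext k
  refine Finset.sum_congr rfl fun w _ => ?_
  rw [dilation_vacuum_apply f hr, List.length_ofFn, Complex.ofReal_one, one_pow, one_mul]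

theorem tendsto_dilation_vacuum (f : Fock n →L[ℂ] Fock n) :
    Tendsto (fun r => dilation f r (fockBasis [])) (𝓝[<] 1) (𝓝 (f (fockBasis []))) := by
  set x := f (fockBasis []) with hx
  rw [tendsto_iff_norm_sub_tendsto_zero]
  have h1 : Tendsto (fun r : ℝ => ∑' α : Word n, ‖((r : ℂ) ^ α.length - 1) * x α‖ ^ 2) (𝓝[<] 1)
      (𝓝 (∑' _ : Word n, (0 : ℝ))) := by
    refine tendsto_tsum_of_dominated_convergence (fock_norm_sq x).summable (fun α => ?_) ?_
    · have hc : Continuous fun r : ℝ => ‖((r : ℂ) ^ α.length - 1) * x α‖ ^ 2 := by fun_prop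
      have := hc.tendsto 1
      simp only [Complex.ofReal_one, one_pow, sub_self, zero_mul, norm_zero, ne_eq,
        OfNat.ofNat_ne_zero, not_false_eq_true, zero_pow] at this
      exact this.mono_left nhdsWithin_le_nhds
    · filter_upwards [eventually_mem_Ioo] with r hr α
      rw [Real.norm_of_nonneg (by positivity), norm_mul, mul_pow]
      refine mul_le_of_le_one_left (by positivity) (pow_le_one₀ (norm_nonneg _) ?_)
      rw [← Complex.ofReal_pow, ← Complex.ofReal_one, ← Complex.ofReal_sub, Complex.norm_real,
        Real.norm_eq_abs, abs_le]
      have h2 := pow_nonneg hr.1.le α.length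
      have h3 := pow_le_one₀ (n := α.length) hr.1.le hr.2.le
      constructor <;> linarith
  rw [tsum_zero] at h1
  have h2 := (Real.continuous_sqrt.tendsto 0).comp h1
  rw [Real.sqrt_zero] at h2
  refine h2.congr' ?_
  filter_upwards [eventually_mem_Ioo] with r hr
  have h3 : ∀ α : Word n, ‖((r : ℂ) ^ α.length - 1) * x α‖
      = ‖(dilation f r (fockBasis []) - x : Fock n) α‖ := fun α => by
    rw [lp.coeFn_sub, Pi.sub_apply, dilation_vacuum_apply f hr, sub_mul, one_mul]
  simp only [Function.comp_apply, h3]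
  rw [(fock_norm_sq _).tsum_eq, Real.sqrt_sq (norm_nonneg _)]

/-- `f(rS) → f` strongly as `r ↑ 1`. -/
theorem tendsto_dilation {f : Fock n →L[ℂ] Fock n} (hf : f ∈ rightCommutant n) (x : Fock n) :
    Tendsto (fun r => dilation f r x) (𝓝[<] 1) (𝓝 (f x)) := by
  refine tendsto_apply_of_dense_span (C := ‖f‖)
    (eventually_mem_Ioo.mono fun r hr => norm_dilation_le hf hr) span_fockBasis ?_ x
  rintro _ ⟨β, rfl⟩
  rw [apply_fockBasis hf]
  refine (((rightCreation β).continuous.tendsto _).comp (tendsto_dilation_vacuum f)).congr' ?_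
  filter_upwards [eventually_mem_Ioo] with r hr
  rw [Function.comp_apply, ← apply_fockBasis
    (toeplitzAlgebra_le_rightCommutant (dilation_mem_toeplitzAlgebra f hr))]

/-- The analytic Toeplitz algebra is the commutant of the right creation operators. -/
theorem rightCommutant_le_toeplitzAlgebra : rightCommutant n ≤ toeplitzAlgebra n := fun f hf =>
  mem_toeplitzAlgebra_of_tendsto
    (eventually_mem_Ioo.mono fun _ hr => dilation_mem_toeplitzAlgebra f hr) (tendsto_dilation hf)

end Dilation

/-! ### The functional calculus of a completely non-coisometric row contraction -/

section Calculus

variable {n : ℕ} {H : Type*} [NormedAddCommGroup H] [InnerProductSpace ℂ H] [CompleteSpace H]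
  {T : Fin n → H →L[ℂ] H}

/-- `f(rT) K_T^* = K_T^* (f(rS) ⊗ I)` converges strongly to `K_T^* (f ⊗ I)`; as the range of `K_T^*`
is dense and `‖f(rT)‖ ≤ ‖f‖`, the strong limit `f(T)` exists and `f(T) K_T^* = K_T^* (f ⊗ I)`. -/
theorem exists_hasFunctionalCalculus (hT : IsRowContraction T)
    (hT_cnc : IsCompletelyNonCoisometric T) (f : toeplitzAlgebra n) :
    ∃ A : H →L[ℂ] H, HasFunctionalCalculus f T A ∧ ∀ (x : Fock n) (y : defectSpace T),
      A ((poissonKernel T hT).adjoint (tensor x y))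
        = (poissonKernel T hT).adjoint (tensor (f.1 x) y) := by
  have hf := toeplitzAlgebra_le_rightCommutant f.2
  have hbd : ∀ᶠ r : ℝ in 𝓝[<] 1, ‖∑' k, homogeneousPart f T r k‖ ≤ ‖f.1‖ :=
    eventually_mem_Ioo.mono fun r hr => norm_tsum_seriesPart_le hT hf hr
  have hlim : ∀ (x : Fock n) (y : defectSpace T),
      Tendsto (fun r : ℝ => (∑' k, homogeneousPart f T r k)
        ((poissonKernel T hT).adjoint (tensor x y))) (𝓝[<] 1)
        (𝓝 ((poissonKernel T hT).adjoint (tensor (f.1 x) y))) := by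
    intro x y
    have h1 := (((poissonKernel T hT).adjoint ∘L tensorRight (Fock n) y).continuous.tendsto _).comp
      (tendsto_dilation hf x)
    refine h1.congr' ?_
    filter_upwards [eventually_mem_Ioo] with r hr
    refine (apply_adjoint_poissonKernel hT
      (toeplitzAlgebra_le_rightCommutant (dilation_mem_toeplitzAlgebra f.1 hr)) ?_ x y).symm
    rw [seriesPart_dilation f.1 T hr]
    exact (summable_seriesPart hT _ hr).hasSum
  obtain ⟨A, -, hA⟩ := exists_tendsto_of_dense hbd
    ((Submodule.dense_iff_topologicalClosure_eq_top).2
      (dense_range_adjoint_poissonKernel hT hT_cnc)) (by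
    intro x hx
    induction hx using Submodule.span_induction with
    | mem x hx =>
      obtain ⟨p, rfl⟩ := hx
      exact ⟨_, hlim p.1 p.2⟩
    | zero => exact ⟨0, by simp⟩
    | add x y _ _ hx hy =>
      obtain ⟨x', hx⟩ := hx
      obtain ⟨y', hy⟩ := hy
      exact ⟨x' + y', by simpa using hx.add hy⟩
    | smul c x _ hx =>
      obtain ⟨x', hx⟩ := hx
      exact ⟨c • x', by simpa using hx.const_smul c⟩)
  exact ⟨A, ⟨fun r hr => summable_seriesPart hT _ hr, hA⟩,
    fun x y => tendsto_nhds_unique (hA _) (hlim x y)⟩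

end Calculus

/-! ### Constrained shifts -/

section Constrained

variable {n : ℕ} {J : TwoSidedIdeal (toeplitzAlgebra n)}

theorem apply_mem_idealSpace {A : Fock n →L[ℂ] Fock n}
    (hA : ∀ φ ∈ J, ∀ x, A ((φ : Fock n →L[ℂ] Fock n) x) ∈ idealSpace J) {x : Fock n}
    (hx : x ∈ idealSpace J) : A x ∈ idealSpace J := by
  have h1 : idealSpace J ≤ (idealSpace J).comap A.toLinearMap := by
    refine Submodule.topologicalClosure_minimal _ (Submodule.span_le.2 ?_)
      ((Submodule.isClosed_topologicalClosure _).preimage A.continuous)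
    rintro _ ⟨φ, hφ, x, rfl⟩
    exact hA φ hφ x
  exact h1 hx

theorem mem_idealSpace {φ : toeplitzAlgebra n} (hφ : φ ∈ J) (x : Fock n) :
    φ.1 x ∈ idealSpace J :=
  Submodule.le_topologicalClosure _ (Submodule.subset_span ⟨φ, hφ, x, rfl⟩)

theorem toeplitz_apply_mem_idealSpace (f : toeplitzAlgebra n) {x : Fock n}
    (hx : x ∈ idealSpace J) : f.1 x ∈ idealSpace J :=
  apply_mem_idealSpace (fun φ hφ x => mem_idealSpace (J.mul_mem_left f φ hφ) x) hx

theorem rightCreation_apply_mem_idealSpace (i : Fin n) {x : Fock n}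
    (hx : x ∈ idealSpace J) : rightCreation [i] x ∈ idealSpace J :=
  apply_mem_idealSpace (fun φ hφ x => by
    rw [← mem_rightCommutant_iff.1 (toeplitzAlgebra_le_rightCommutant φ.2)]
    exact mem_idealSpace hφ _) hx

theorem constrainedProj_eq_zero_iff {x : Fock n} : constrainedProj J x = 0 ↔ x ∈ idealSpace J := by
  have : CompleteSpace (idealSpace J) :=
    (Submodule.isClosed_topologicalClosure _).completeSpace_coe
  rw [constrainedProj, Submodule.orthogonalProjectionOnto_eq_zero_iff,
    Submodule.orthogonal_orthogonal]

theorem constrainedProj_coe (u : constrainedSpace J) : constrainedProj J u = u :=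
  Submodule.orthogonalProjectionOnto_mem_subspace_eq_self u

theorem sub_constrainedProj_mem (x : Fock n) : x - constrainedProj J x ∈ idealSpace J := by
  rw [← constrainedProj_eq_zero_iff, map_sub, constrainedProj_coe, sub_self]

theorem norm_constrainedProj_le : ‖constrainedProj J‖ ≤ 1 :=
  Submodule.orthogonalProjectionOnto_norm_le _

theorem adjoint_constrainedProj_apply (u : constrainedSpace J) :
    (constrainedProj J).adjoint u = (u : Fock n) := by
  rw [constrainedProj, Submodule.adjoint_orthogonalProjectionOnto]
  rfl

variable (J) in
/-- The compression `P_{𝓝_J} A |_{𝓝_J}` of an operator on the Fock space. -/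
def compression (A : Fock n →L[ℂ] Fock n) : constrainedSpace J →L[ℂ] constrainedSpace J :=
  constrainedProj J ∘L A ∘L (constrainedSpace J).subtypeL

theorem norm_compression_le (A : Fock n →L[ℂ] Fock n) : ‖compression J A‖ ≤ ‖A‖ := by
  refine ContinuousLinearMap.opNorm_le_bound _ (norm_nonneg _) fun u => ?_
  refine ((constrainedProj J).le_of_opNorm_le norm_constrainedProj_le _).trans ?_
  rw [one_mul]
  exact A.le_opNorm u

theorem compression_constrainedProj {A : Fock n →L[ℂ] Fock n}
    (hA : ∀ x ∈ idealSpace J, A x ∈ idealSpace J) (x : Fock n) :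
    compression J A (constrainedProj J x) = constrainedProj J (A x) := by
  rw [← sub_eq_zero, ← neg_sub, neg_eq_zero]
  change constrainedProj J (A x) - constrainedProj J (A (constrainedProj J x : Fock n)) = 0
  rw [← map_sub, ← map_sub, constrainedProj_eq_zero_iff]
  exact hA _ (sub_constrainedProj_mem x)

theorem wordOp_constrainedShift (α : Word n) :
    wordOp (constrainedShift J) α = compression J (wordOp leftCreation α) := by
  have h : ∀ x, wordOp (constrainedShift J) α (constrainedProj J x)
      = constrainedProj J (wordOp leftCreation α x) := by
    induction α with
    | nil => simp [wordOp]
    | cons i α ih =>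
      intro x
      have h1 : wordOp (constrainedShift J) (i :: α)
          = constrainedShift J i * wordOp (constrainedShift J) α := by simp [wordOp]
      have h2 : wordOp leftCreation (i :: α)
          = leftCreation i * wordOp leftCreation α := by simp [wordOp]
      rw [h1, h2, mul_apply_eq_comp, mul_apply_eq_comp, ih]
      exact compression_constrainedProj (fun y hy => toeplitz_apply_mem_idealSpace
        ⟨_, leftCreation_mem_toeplitzAlgebra i⟩ hy) _
  ext1 u
  conv_lhs => rw [← constrainedProj_coe u, h]
  rfl

variable (J) in
/-- Compression to `𝓝_J` as a bounded linear map. -/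
def compressionL :
    (Fock n →L[ℂ] Fock n) →L[ℂ] (constrainedSpace J →L[ℂ] constrainedSpace J) :=
  LinearMap.mkContinuous
    { toFun := compression J
      map_add' := fun A B => by ext1 u; simp [compression]
      map_smul' := fun c A => by ext1 u; simp [compression] }
    1 fun A => by rw [one_mul]; exact norm_compression_le A

theorem seriesPart_constrainedShift (x : Fock n) (r : ℝ) (k : ℕ) :
    seriesPart x (constrainedShift J) r k = compressionL J (seriesPart x leftCreation r k) := by
  simp only [seriesPart, map_sum, map_smul, wordOp_constrainedShift]
  rfl

theorem hasSum_homogeneousPart_constrainedShift (f : toeplitzAlgebra n) {r : ℝ}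
    (hr : r ∈ Set.Ioo (0 : ℝ) 1) :
    HasSum (homogeneousPart f (constrainedShift J) r) (compression J (dilation f.1 r)) := by
  rw [homogeneousPart_eq, funext (seriesPart_constrainedShift (J := J) _ r)]
  exact (compressionL J).hasSum (hasSum_dilation f.1 hr)

/-- `f(B)` is the compression of `f`, because `f(rB)` is that of `f(rS)`. -/
theorem hasFunctionalCalculus_compression (f : toeplitzAlgebra n) :
    HasFunctionalCalculus f (constrainedShift J) (compression J f.1) := by
  refine ⟨fun r hr => (hasSum_homogeneousPart_constrainedShift f hr).summable, fun u => ?_⟩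
  have h1 := ((constrainedProj J).continuous.tendsto _).comp
    (tendsto_dilation (toeplitzAlgebra_le_rightCommutant f.2) (u : Fock n))
  refine h1.congr' ?_
  filter_upwards [eventually_mem_Ioo] with r hr
  rw [(hasSum_homogeneousPart_constrainedShift f hr).tsum_eq]
  rfl

/-! ### The constrained Poisson kernel -/

variable {H : Type*} [NormedAddCommGroup H] [InnerProductSpace ℂ H] [CompleteSpace H]
  {T : Fin n → H →L[ℂ] H}

/-- The range of `K_T` lies in `𝓝_J ⊗ 𝓓_T` when `J` annihilates `T`. -/
theorem adjoint_poissonKernel_idealSpace (hT : IsRowContraction T)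
    (hT_cnc : IsCompletelyNonCoisometric T) (hT_J : ∀ φ ∈ J, HasFunctionalCalculus φ T 0)
    {x : Fock n} (hx : x ∈ idealSpace J) (y : defectSpace T) :
    (poissonKernel T hT).adjoint (tensor x y) = 0 := by
  have h1 : idealSpace J
      ≤ LinearMap.ker ((poissonKernel T hT).adjoint ∘L tensorRight (Fock n) y).toLinearMap := by
    refine Submodule.topologicalClosure_minimal _ (Submodule.span_le.2 ?_)
      (ContinuousLinearMap.isClosed_ker _)
    rintro _ ⟨φ, hφ, x, rfl⟩
    obtain ⟨A, hA, hAK⟩ := exists_hasFunctionalCalculus hT hT_cnc φ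
    have hA0 : A ((poissonKernel T hT).adjoint (tensor x y)) = 0 :=
      tendsto_nhds_unique (hA.tendsto _) ((hT_J φ hφ).tendsto _)
    rw [hAK] at hA0
    exact hA0
  exact h1 hx

theorem constrainedPoissonKernel_intertwine (hT : IsRowContraction T)
    (hT_cnc : IsCompletelyNonCoisometric T) (hT_J : ∀ φ ∈ J, HasFunctionalCalculus φ T 0)
    {f : Fock n →L[ℂ] Fock n} {A : H →L[ℂ] H} (hA : ∀ (x : Fock n) (y : defectSpace T),
      A ((poissonKernel T hT).adjoint (tensor x y))
        = (poissonKernel T hT).adjoint (tensor (f x) y)) :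
    constrainedPoissonKernel J T hT ∘L A.adjoint
      = tensorOp (compression J f).adjoint (ContinuousLinearMap.id ℂ (defectSpace T)) ∘L
        constrainedPoissonKernel J T hT := by
  ext1 h
  refine ext_inner_tensor fun u y => ?_
  simp only [constrainedPoissonKernel, ContinuousLinearMap.comp_apply, inner_tensor_tensorOp,
    ContinuousLinearMap.adjoint_adjoint, adjoint_constrainedProj_apply]
  rw [← ContinuousLinearMap.adjoint_inner_left, ← ContinuousLinearMap.adjoint_inner_left,
    ContinuousLinearMap.adjoint_adjoint, ← ContinuousLinearMap.adjoint_inner_left, hA]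
  congr 1
  have h1 := adjoint_poissonKernel_idealSpace hT hT_cnc hT_J (sub_constrainedProj_mem (f u)) y
  have h2 := (((poissonKernel T hT).adjoint ∘L tensorRight (Fock n) y)).map_sub (f u)
    (constrainedProj J (f u) : Fock n)
  exact sub_eq_zero.1 (h2.symm.trans h1)

end Constrained

/-! ### The `w*`-topology -/

section WeakStar

variable {E : Type*} [NormedAddCommGroup E] [InnerProductSpace ℂ E]

theorem continuous_weakStar (x y : lp (fun _ : ℕ => E) 2) :
    Continuous[weakStarTopology E, inferInstance] fun A : E →L[ℂ] E => ∑' k, ⟪y k, A (x k)⟫_ℂ :=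
  continuous_iInf_dom (i := x) (continuous_iInf_dom (i := y) continuous_induced_dom)

theorem continuous_weakStar_inner (x y : E) :
    Continuous[weakStarTopology E, inferInstance] fun A : E →L[ℂ] E => ⟪y, A x⟫_ℂ := by
  have h := continuous_weakStar (lp.single 2 0 x) (lp.single 2 0 y)
  convert h using 2 with A
  rw [tsum_eq_single 0]
  · simp
  · intro k hk
    rw [lp.single_apply_ne _ _ _ hk, lp.single_apply_ne _ _ _ hk, inner_zero_left]

/-- A bounded strongly convergent family converges in the `w*`-topology. -/
theorem tendsto_weakStar {ι : Type*} {l : Filter ι} [l.IsCountablyGenerated]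
    {A : ι → E →L[ℂ] E} {B : E →L[ℂ] E}
    {C : ℝ} (hC : ∀ᶠ i in l, ‖A i‖ ≤ C) (h : ∀ x, Tendsto (fun i => A i x) l (𝓝 (B x))) :
    Tendsto A l (@nhds _ (weakStarTopology E) B) := by
  simp only [nhds_iInf, nhds_induced, tendsto_iInf, tendsto_comap_iff]
  intro x y
  have hs : Summable fun k => C * (‖x k‖ ^ 2 + ‖y k‖ ^ 2) := by
    have hx := (lp.hasSum_norm (p := 2) (by simp) x).summable
    have hy := (lp.hasSum_norm (p := 2) (by simp) y).summable
    simp only [ENNReal.toReal_ofNat, Real.rpow_ofNat] at hx hy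
    exact (hx.add hy).mul_left C
  refine tendsto_tsum_of_dominated_convergence hs
    (fun k => ((innerSL ℂ (y k)).continuous.tendsto _).comp (h (x k))) ?_
  filter_upwards [hC] with i hi k
  have h1 := (A i).le_of_opNorm_le hi (x k)
  have h2 := norm_inner_le_norm (𝕜 := ℂ) (y k) (A i (x k))
  have hC0 : 0 ≤ C := (norm_nonneg _).trans hi
  calc _ ≤ ‖y k‖ * (C * ‖x k‖) := h2.trans (mul_le_mul_of_nonneg_left h1 (norm_nonneg _))
    _ ≤ C * (‖x k‖ ^ 2 + ‖y k‖ ^ 2) := by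
      nlinarith [mul_nonneg hC0 (sq_nonneg (‖x k‖ - ‖y k‖)),
        mul_nonneg hC0 (add_nonneg (sq_nonneg ‖x k‖) (sq_nonneg ‖y k‖))]

theorem mem_weakStarAlgebra_of_tendsto {n : ℕ} {T : Fin n → E →L[ℂ] E} {ι : Type*} {l : Filter ι}
    [l.NeBot] [l.IsCountablyGenerated] {A : ι → E →L[ℂ] E} {B : E →L[ℂ] E} {C : ℝ}
    (hA : ∀ᶠ i in l, A i ∈ weakStarAlgebra T)
    (hC : ∀ᶠ i in l, ‖A i‖ ≤ C) (h : ∀ x, Tendsto (fun i => A i x) l (𝓝 (B x))) :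
    B ∈ weakStarAlgebra T := by
  refine Algebra.mem_sInf.2 fun 𝒜 h𝒜 => ?_
  have h1 : ∀ᶠ i in l, A i ∈ 𝒜 := hA.mono fun i hi => Algebra.mem_sInf.1 hi 𝒜 h𝒜
  let _ : TopologicalSpace (E →L[ℂ] E) := weakStarTopology E
  exact IsClosed.mem_of_tendsto h𝒜.1 (tendsto_weakStar hC h) h1

theorem isWeakStarClosed_centralizer [CompleteSpace E] (s : Set (E →L[ℂ] E)) :
    IsWeakStarClosed (Subalgebra.centralizer ℂ s : Set (E →L[ℂ] E)) := by
  have : (Subalgebra.centralizer ℂ s : Set (E →L[ℂ] E))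
      = ⋂ (C ∈ s) (x : E) (y : E), {A | ⟪C.adjoint y, A x⟫_ℂ = ⟪y, A (C x)⟫_ℂ} := by
    ext A
    simp only [SetLike.mem_coe, mem_centralizer_iff_inner, Set.mem_iInter, Set.mem_ofPred_eq]
  rw [IsWeakStarClosed, this]
  let _ : TopologicalSpace (E →L[ℂ] E) := weakStarTopology E
  exact isClosed_iInter fun C => isClosed_iInter fun _ => isClosed_iInter fun x =>
    isClosed_iInter fun y =>
      isClosed_eq (continuous_weakStar_inner _ _) (continuous_weakStar_inner _ _)

end WeakStar

section Constrained

variable {n : ℕ} {J : TwoSidedIdeal (toeplitzAlgebra n)}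

theorem homogeneousPart_mem_weakStarAlgebra {E : Type*} [NormedAddCommGroup E]
    [InnerProductSpace ℂ E] (f : toeplitzAlgebra n) (T : Fin n → E →L[ℂ] E) (r : ℝ) (k : ℕ) :
    homogeneousPart f T r k ∈ weakStarAlgebra T := by
  refine Subalgebra.sum_mem _ fun w _ => Subalgebra.smul_mem _ ?_ _
  refine Subalgebra.list_prod_mem _ fun A hA => ?_
  obtain ⟨i, -, rfl⟩ := List.mem_map.1 hA
  exact Algebra.mem_sInf.2 fun _ h => h.2 i

theorem compression_dilation_mem_weakStarAlgebra (f : toeplitzAlgebra n) {r : ℝ}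
    (hr : r ∈ Set.Ioo (0 : ℝ) 1) :
    compression J (dilation f.1 r) ∈ weakStarAlgebra (constrainedShift J) := by
  have h1 := (hasSum_homogeneousPart_constrainedShift (J := J) f hr).tendsto_sum_nat
  obtain ⟨C, hC⟩ := h1.norm.bddAbove_range
  exact mem_weakStarAlgebra_of_tendsto (l := atTop)
    (Eventually.of_forall fun m => Subalgebra.sum_mem _ fun k _ =>
      homogeneousPart_mem_weakStarAlgebra f _ r k)
    (Eventually.of_forall fun m => hC ⟨m, rfl⟩)
    fun u => ((ContinuousLinearMap.apply ℂ (constrainedSpace J) u).continuous.tendsto _).comp h1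

theorem mem_weakStarAlgebra_of_hasFunctionalCalculus {f : toeplitzAlgebra n}
    {X : constrainedSpace J →L[ℂ] constrainedSpace J}
    (hX : HasFunctionalCalculus f (constrainedShift J) X) :
    X ∈ weakStarAlgebra (constrainedShift J) := by
  refine mem_weakStarAlgebra_of_tendsto (C := ‖f.1‖)
    (A := fun r : ℝ => ∑' k, homogeneousPart f (constrainedShift J) r k) (l := 𝓝[<] 1)
    ?_ ?_ hX.tendsto
  · filter_upwards [eventually_mem_Ioo] with r hr
    rw [(hasSum_homogeneousPart_constrainedShift f hr).tsum_eq]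
    exact compression_dilation_mem_weakStarAlgebra f hr
  · filter_upwards [eventually_mem_Ioo] with r hr
    rw [(hasSum_homogeneousPart_constrainedShift f hr).tsum_eq]
    exact (norm_compression_le _).trans
      (norm_dilation_le (toeplitzAlgebra_le_rightCommutant f.2) hr)

theorem compression_comm {A B : Fock n →L[ℂ] Fock n}
    (hA : ∀ x ∈ idealSpace J, A x ∈ idealSpace J) (hB : ∀ x ∈ idealSpace J, B x ∈ idealSpace J)
    (h : ∀ x, A (B x) = B (A x)) :
    compression J A * compression J B = compression J B * compression J A := by
  ext1 u
  rw [mul_apply_eq_comp, mul_apply_eq_comp]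
  change compression J A (constrainedProj J (B u)) = compression J B (constrainedProj J (A u))
  rw [compression_constrainedProj hA, compression_constrainedProj hB, h]

/-- Elements of `𝓦(B_1, …, B_n)` commute with the compressed right creation operators. -/
theorem weakStarAlgebra_le_centralizer : weakStarAlgebra (constrainedShift J) ≤
    Subalgebra.centralizer ℂ (Set.range fun i : Fin n => compression J (rightCreation [i])) := by
  refine sInf_le ⟨isWeakStarClosed_centralizer _, fun j => ?_⟩
  rw [Subalgebra.mem_centralizer_iff]
  rintro _ ⟨i, rfl⟩
  exact compression_comm (fun x hx => rightCreation_apply_mem_idealSpace i hx)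
    (fun x hx => toeplitz_apply_mem_idealSpace ⟨_, leftCreation_mem_toeplitzAlgebra j⟩ hx)
    fun x => (mem_rightCommutant_iff.1 (leftCreation_mem_rightCommutant j) i x).symm

end Constrained

/-! ### Lifting the commutant of the compressed right creation operators -/

section Extension

variable {E K₁ K₂ : Type*} [AddCommGroup E] [Module ℂ E] [NormedAddCommGroup K₁]
  [InnerProductSpace ℂ K₁] [CompleteSpace K₁] [NormedAddCommGroup K₂] [InnerProductSpace ℂ K₂]
  [CompleteSpace K₂]

/-- Douglas' lemma: `‖W x‖ ≤ ‖G x‖` for all `x` gives a contraction `V` with `V G = W`. -/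
theorem exists_contraction_comp_eq (G : E →ₗ[ℂ] K₁) (W : E →ₗ[ℂ] K₂) (h : ∀ x, ‖W x‖ ≤ ‖G x‖) :
    ∃ V : K₁ →L[ℂ] K₂, (∀ z, ‖V z‖ ≤ ‖z‖) ∧ ∀ x, V (G x) = W x := by
  set S := (LinearMap.range G).topologicalClosure with hS
  have hmem : ∀ x, G x ∈ S := fun x => Submodule.le_topologicalClosure _ ⟨x, rfl⟩
  let e : E →ₗ[ℂ] S := G.codRestrict S hmem
  have hS' : CompleteSpace S := (Submodule.isClosed_topologicalClosure _).completeSpace_coe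
  have hd : DenseRange e := by
    intro z
    rw [closure_subtype]
    have h1 : (Subtype.val '' Set.range e) = (LinearMap.range G : Set K₁) := by
      ext w
      constructor
      · rintro ⟨_, ⟨x, rfl⟩, rfl⟩
        exact ⟨x, rfl⟩
      · rintro ⟨x, rfl⟩
        exact ⟨e x, ⟨x, rfl⟩, rfl⟩
    rw [h1]
    exact z.2
  have he : ∀ x, ‖W x‖ ≤ 1 * ‖e x‖ := fun x => by rw [one_mul]; exact h x
  refine ⟨W.extendOfNorm e ∘L S.orthogonalProjectionOnto, fun z => ?_, fun x => ?_⟩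
  · refine (LinearMap.norm_extendOfNorm_apply_le hd 1 he _).trans ?_
    rw [one_mul]
    simpa using S.orthogonalProjectionOnto.le_of_opNorm_le S.orthogonalProjectionOnto_norm_le z
  · rw [ContinuousLinearMap.comp_apply]
    have h1 : S.orthogonalProjectionOnto (G x) = e x :=
      Submodule.orthogonalProjectionOnto_mem_subspace_eq_self (e x)
    rw [h1, LinearMap.extendOfNorm_eq hd ⟨1, he⟩]

end Extension

section Observability

variable {n : ℕ}

theorem fock_eq_vacuum_add (y : Fock n) :
    y = y [] • fockBasis [] + ∑ i, rightCreation [i] ((rightCreation [i]).adjoint y) := by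
  have h : (1 : Fock n →L[ℂ] Fock n).toLinearMap
      = ((innerSL ℂ (fockBasis [] : Fock n)).smulRight (fockBasis [])
        + ∑ i, rightCreation [i] ∘L (rightCreation [i]).adjoint).toLinearMap := by
    rw [← ext_inner_map]
    intro x
    simp only [ContinuousLinearMap.coe_coe, add_apply, sum_apply, one_apply_eq_self,
      ContinuousLinearMap.smulRight_apply, innerSL_apply_apply, inner_fockBasis_left,
      inner_add_left, inner_smul_left, sum_inner, ContinuousLinearMap.comp_apply]
    have h0 : ∀ i, ⟪rightCreation [i] ((rightCreation [i]).adjoint x), x⟫_ℂ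
        = (‖(rightCreation [i]).adjoint x‖ : ℂ) ^ 2 := fun i => by
      rw [← ContinuousLinearMap.adjoint_inner_right]
      exact inner_self_eq_norm_sq_to_K (𝕜 := ℂ) _
    simp only [h0, inner_self_eq_norm_sq_to_K, RCLike.conj_mul]
    have h1 := congrArg ((↑) : ℝ → ℂ) (norm_sq_eq_right x)
    push_cast at h1
    exact h1
  simpa [inner_fockBasis_left] using DFunLike.congr_fun h y

theorem adjoint_rightCreation_append (β : Word n) (i : Fin n) (y : Fock n) :
    (rightCreation (β ++ [i])).adjoint y
      = (rightCreation β).adjoint ((rightCreation [i]).adjoint y) := by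
  ext α
  simp only [adjoint_rightCreation_apply, List.append_assoc]

theorem sum_range_words_norm_sq (m : ℕ) (y : Fock n) :
    ∑ k ∈ Finset.range m, ∑ w : Fin k → Fin n, ‖y (List.ofFn w)‖ ^ 2
      = ‖y‖ ^ 2 - ∑ w : Fin m → Fin n, ‖(rightCreation (List.ofFn w)).adjoint y‖ ^ 2 := by
  induction m generalizing y with
  | zero =>
    have h1 : (1 : Fock n →L[ℂ] Fock n).adjoint = 1 := star_one (Fock n →L[ℂ] Fock n)
    simp [rightCreation_nil, h1]
  | succ m ih =>
    rw [Finset.sum_range_succ', sum_words_succ fun α => ‖(rightCreation α).adjoint y‖ ^ 2]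
    simp only [sum_words_succ fun α => ‖y α‖ ^ 2, adjoint_rightCreation_append]
    rw [Finset.sum_comm]
    have h1 : ∀ i, ∑ k ∈ Finset.range m, ∑ w : Fin k → Fin n, ‖y (List.ofFn w ++ [i])‖ ^ 2 = _ :=
      fun i => by simpa only [adjoint_rightCreation_apply] using ih ((rightCreation [i]).adjoint y)
    rw [Finset.sum_congr rfl fun i _ => h1 i, Finset.sum_sub_distrib, norm_sq_eq_right y]
    simp
    ring

/-- The adjoints of the right creation operators form a pure family. -/
theorem tendsto_sum_words_adjoint_rightCreation (y : Fock n) :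
    Tendsto (fun m => ∑ w : Fin m → Fin n, ‖(rightCreation (List.ofFn w)).adjoint y‖ ^ 2)
      atTop (𝓝 0) := by
  have h1 := (hasSum_levels (fock_norm_sq y)).tendsto_sum_nat.const_sub (‖y‖ ^ 2)
  simpa only [sum_range_words_norm_sq, sub_sub_cancel, sub_self] using h1

/-- The observability operator of a system on words with state space `E`, transition operators
`L i` and output functional `q`: a vector `x` is sent to the family of all outputs
`q (L_{i_1} ⋯ L_{i_k} x)`. It intertwines `L i` and the adjoints of the right creation
operators. -/
theorem exists_observability {E : Type*} [NormedAddCommGroup E] [NormedSpace ℂ E]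
    (L : Fin n → E →L[ℂ] E) (q : E →L[ℂ] ℂ) {N : E → ℝ} (hN : ∀ x, 0 ≤ N x)
    (hN' : ∀ x, N x ≤ ‖x‖ ^ 2) (h : ∀ x, ‖q x‖ ^ 2 + ∑ i, N (L i x) ≤ N x) :
    ∃ G : E →L[ℂ] Fock n, ‖G‖ ≤ 1 ∧ (∀ x, G x [] = q x) ∧
      ∀ i x, (rightCreation [i]).adjoint (G x) = G (L i x) := by
  have hs := fun x => summable_of_energy (L := fun i => L i) (q := fun x => ‖q x‖ ^ 2)
    (fun x => by positivity) hN h x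
  let g : E → Fock n := fun x => ⟨fun α => q (α.foldr (fun i => L i) x),
    memℓp_gen (by simpa using (hs x).1)⟩
  have hg : ∀ x α, g x α = q (α.foldr (fun i => L i) x) := fun _ _ => rfl
  have hadd : ∀ (α : Word n) (x y : E), α.foldr (fun i => L i) (x + y)
      = α.foldr (fun i => L i) x + α.foldr (fun i => L i) y := by
    intro α x y
    induction α with
    | nil => rfl
    | cons i α ih => rw [List.foldr_cons, ih, map_add]; rfl
  have hsmul : ∀ (α : Word n) (c : ℂ) (x : E), α.foldr (fun i => L i) (c • x)
      = c • α.foldr (fun i => L i) x := by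
    intro α c x
    induction α with
    | nil => rfl
    | cons i α ih => rw [List.foldr_cons, ih, map_smul]; rfl
  refine ⟨LinearMap.mkContinuous
    { toFun := g
      map_add' := fun x y => by ext α; simp [hg, hadd]
      map_smul' := fun c x => by ext α; simp [hg, hsmul] } 1 fun x => ?_,
    LinearMap.mkContinuous_norm_le _ zero_le_one _, fun x => rfl, fun i x => ?_⟩
  · rw [one_mul]
    refine le_of_sq_le_sq ?_ (norm_nonneg _)
    change ‖g x‖ ^ 2 ≤ _
    rw [← (fock_norm_sq (g x)).tsum_eq]
    exact (hs x).2.trans (hN' x)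
  · ext α
    rw [adjoint_rightCreation_apply]
    change g x _ = g _ _
    rw [hg, hg, List.foldr_append]
    rfl

/-- A contractive operator colligation `(x, t) ↦ (∑ a_i x_i + t b, ∑ c_i x_i + t d)` is the
realization of a bounded operator `Y` commuting with the adjoints of the right creation operators;
`s y` is the state reached under the input `y`. -/
theorem exists_transfer {D : Type*} [NormedAddCommGroup D] [InnerProductSpace ℂ D]
    [CompleteSpace D] (a : Fin n → D →L[ℂ] D) (b : D) (c : Fin n → D →L[ℂ] ℂ) (d : ℂ)
    (h : ∀ (v : Fin n → D) (t : ℂ), ‖∑ i, a i (v i) + t • b‖ ^ 2 + ‖∑ i, c i (v i) + t * d‖ ^ 2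
      ≤ ∑ i, ‖v i‖ ^ 2 + ‖t‖ ^ 2) :
    ∃ (s : Fock n →L[ℂ] D) (Y : Fock n →L[ℂ] Fock n),
      (∀ y, s y = ∑ i, a i (s ((rightCreation [i]).adjoint y)) + y [] • b) ∧
      (∀ y, Y y [] = ∑ i, c i (s ((rightCreation [i]).adjoint y)) + y [] * d) ∧
      ∀ i y, (rightCreation [i]).adjoint (Y y) = Y ((rightCreation [i]).adjoint y) := by
  -- The row `[a_1, …, a_n, b]` is a contraction, hence so is its adjoint column.
  have hcol : ∀ v : D, ‖innerSL ℂ b v‖ ^ 2 + ∑ i, ‖(a i).adjoint v‖ ^ 2 ≤ ‖v‖ ^ 2 := by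
    intro v
    set q := ‖innerSL ℂ b v‖ ^ 2 + ∑ i, ‖(a i).adjoint v‖ ^ 2 with hq
    have hq0 : 0 ≤ q := by positivity
    set w := ∑ i, a i ((a i).adjoint v) + ⟪b, v⟫_ℂ • b with hw
    have h1 : ‖w‖ ^ 2 ≤ q := by
      have := h (fun i => (a i).adjoint v) ⟪b, v⟫_ℂ
      rw [innerSL_apply_apply] at hq
      nlinarith [sq_nonneg ‖∑ i, c i ((a i).adjoint v) + ⟪b, v⟫_ℂ * d‖]
    have h2 : ⟪v, w⟫_ℂ = ((q : ℝ) : ℂ) := by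
      rw [hw, hq, inner_add_right, inner_sum, inner_smul_right, ← inner_conj_symm v b,
        Complex.mul_conj, innerSL_apply_apply]
      push_cast
      rw [add_comm]
      congr 1
      · rw [Complex.normSq_eq_norm_sq]; push_cast; rfl
      · refine Finset.sum_congr rfl fun i _ => ?_
        rw [← ContinuousLinearMap.adjoint_inner_left]
        exact inner_self_eq_norm_sq_to_K (𝕜 := ℂ) _
    have h3 : q ≤ ‖v‖ * ‖w‖ := by
      have := norm_inner_le_norm (𝕜 := ℂ) v w
      rwa [h2, Complex.norm_real, Real.norm_of_nonneg hq0] at this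
    nlinarith [sq_nonneg (‖v‖ - ‖w‖)]
  obtain ⟨G, hG1, hG0, hGR⟩ := exists_observability (fun i => (a i).adjoint) (innerSL ℂ b)
    (N := fun v => ‖v‖ ^ 2) (fun v => by positivity) (fun v => le_rfl) hcol
  have hs0 : G.adjoint (fockBasis []) = b := ext_inner_left ℂ fun v => by
    rw [ContinuousLinearMap.adjoint_inner_right, ← inner_conj_symm, inner_fockBasis_left, hG0,
      innerSL_apply_apply, inner_conj_symm]
  have hsR : ∀ i y, G.adjoint (rightCreation [i] y) = a i (G.adjoint y) := fun i y =>
    ext_inner_left ℂ fun v => by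
      rw [ContinuousLinearMap.adjoint_inner_right, ← ContinuousLinearMap.adjoint_inner_left, hGR,
        ← ContinuousLinearMap.adjoint_inner_right, ContinuousLinearMap.adjoint_inner_left]
  have hs : ∀ y, G.adjoint y
      = ∑ i, a i (G.adjoint ((rightCreation [i]).adjoint y)) + y [] • b := fun y => by
    conv_lhs => rw [fock_eq_vacuum_add y, map_add, map_smul, map_sum, hs0, add_comm]
    simp only [hsR]
  have hs1 : ∀ y, ‖G.adjoint y‖ ^ 2 ≤ ‖y‖ ^ 2 := fun y => by
    refine pow_le_pow_left₀ (norm_nonneg _) ?_ 2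
    have h1 : ‖G.adjoint‖ ≤ 1 := by rwa [ContinuousLinearMap.adjoint.norm_map]
    simpa using G.adjoint.le_of_opNorm_le h1 y
  let o : Fock n →L[ℂ] ℂ := ∑ i, c i ∘L G.adjoint ∘L (rightCreation [i]).adjoint
    + d • innerSL ℂ (fockBasis [])
  have ho : ∀ y, o y = ∑ i, c i (G.adjoint ((rightCreation [i]).adjoint y)) + y [] * d := by
    intro y
    simp [o, inner_fockBasis_left, mul_comm]
  obtain ⟨Y, -, hY0, hYR⟩ := exists_observability (fun i => (rightCreation [i]).adjoint) o
    (N := fun y => ‖y‖ ^ 2 - ‖G.adjoint y‖ ^ 2) (fun y => sub_nonneg.2 (hs1 y))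
    (fun y => sub_le_self _ (by positivity)) fun y => by
      have h1 := h (fun i => G.adjoint ((rightCreation [i]).adjoint y)) (y [])
      rw [← hs, ← ho] at h1
      rw [Finset.sum_sub_distrib, norm_sq_eq_right y]
      linarith
  exact ⟨G.adjoint, Y, hs, fun y => (hY0 y).trans (ho y), hYR⟩

end Observability

section Lifting

variable {n : ℕ}

/-- The lurking isometry: if the `n + 1` operators `δ' i`, `ε` and the two operators `δ`, `ε'` have
the same total energy at each vector, then a contractive colligation maps the values of the former
to those of the latter. -/
theorem exists_colligation {E D : Type*} [NormedAddCommGroup E] [NormedSpace ℂ E]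
    [NormedAddCommGroup D] [InnerProductSpace ℂ D] [CompleteSpace D] (δ' : Fin n → E →L[ℂ] D)
    (ε : E →L[ℂ] ℂ) (δ : E →L[ℂ] D) (ε' : E →L[ℂ] ℂ)
    (h : ∀ y, ‖δ y‖ ^ 2 + ‖ε' y‖ ^ 2 = ∑ i, ‖δ' i y‖ ^ 2 + ‖ε y‖ ^ 2) :
    ∃ (a : Fin n → D →L[ℂ] D) (b : D) (c : Fin n → D →L[ℂ] ℂ) (d : ℂ),
      (∀ (v : Fin n → D) (t : ℂ), ‖∑ i, a i (v i) + t • b‖ ^ 2 + ‖∑ i, c i (v i) + t * d‖ ^ 2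
        ≤ ∑ i, ‖v i‖ ^ 2 + ‖t‖ ^ 2) ∧
      (∀ y, δ y = ∑ i, a i (δ' i y) + ε y • b) ∧
      ∀ y, ε' y = ∑ i, c i (δ' i y) + ε y * d := by
  let ι : ((Fin n → D) × ℂ) →L[ℂ] WithLp 2 (PiLp 2 (fun _ : Fin n => D) × ℂ) :=
    (WithLp.prodContinuousLinearEquiv 2 ℂ (PiLp 2 (fun _ : Fin n => D)) ℂ).symm ∘L
      ((PiLp.continuousLinearEquiv 2 ℂ (fun _ : Fin n => D)).symm.toContinuousLinearMap.prodMap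
        (ContinuousLinearMap.id ℂ ℂ))
  let κ := WithLp.prodContinuousLinearEquiv 2 ℂ D ℂ
  have hι : ∀ p, ‖ι p‖ ^ 2 = ∑ i, ‖p.1 i‖ ^ 2 + ‖p.2‖ ^ 2 := fun p =>
    (WithLp.prod_norm_sq_eq_of_L2 (ι p)).trans
      (congrArg (· + ‖p.2‖ ^ 2) (PiLp.norm_sq_eq_of_L2 _ _))
  have hκ : ∀ p, ‖κ.symm p‖ ^ 2 = ‖p.1‖ ^ 2 + ‖p.2‖ ^ 2 := fun p =>
    WithLp.prod_norm_sq_eq_of_L2 (κ.symm p)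
  obtain ⟨V, hV, hVG⟩ := exists_contraction_comp_eq
    (ι ∘L (ContinuousLinearMap.pi δ').prod ε).toLinearMap
    (κ.symm.toContinuousLinearMap ∘L δ.prod ε').toLinearMap fun y => by
      refine le_of_eq ((pow_left_inj₀ (norm_nonneg _) (norm_nonneg _) two_ne_zero).1 ?_)
      exact (hκ (δ y, ε' y)).trans ((h y).trans (hι (fun i => δ' i y, ε y)).symm)
  let V' : ((Fin n → D) × ℂ) →L[ℂ] D × ℂ := κ.toContinuousLinearMap ∘L V ∘L ι
  have hV' : ∀ p, ‖(V' p).1‖ ^ 2 + ‖(V' p).2‖ ^ 2 ≤ ∑ i, ‖p.1 i‖ ^ 2 + ‖p.2‖ ^ 2 := fun p => by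
    rw [← hκ, ← hι]
    refine pow_le_pow_left₀ (norm_nonneg _) ?_ 2
    simpa [V'] using hV (ι p)
  have hV'G : ∀ y, V' (fun i => δ' i y, ε y) = (δ y, ε' y) := fun y => by
    exact (congrArg κ (hVG y)).trans (κ.apply_symm_apply _)
  have hdecomp : ∀ (v : Fin n → D) (t : ℂ),
      V' (v, t) = ∑ i, V' (Pi.single i (v i), 0) + t • V' (0, 1) := fun v t => by
    rw [← map_sum, ← map_smul, ← map_add]
    congr 1
    ext i
    · simp [Prod.fst_sum, Finset.sum_apply, Finset.sum_pi_single]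
    · simp [Prod.snd_sum]
  let a : Fin n → D →L[ℂ] D × ℂ := fun i =>
    V' ∘L ContinuousLinearMap.inl ℂ _ _ ∘L ContinuousLinearMap.single ℂ (fun _ : Fin n => D) i
  have ha : ∀ (v : Fin n → D) (t : ℂ), V' (v, t) = ∑ i, a i (v i) + t • V' (0, 1) := hdecomp
  have ha1 : ∀ (v : Fin n → D) (t : ℂ),
      (V' (v, t)).1 = ∑ i, (a i (v i)).1 + t • (V' (0, 1)).1 := fun v t => by
    rw [ha, Prod.fst_add, Prod.fst_sum, Prod.smul_fst]
  have ha2 : ∀ (v : Fin n → D) (t : ℂ),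
      (V' (v, t)).2 = ∑ i, (a i (v i)).2 + t * (V' (0, 1)).2 := fun v t => by
    rw [ha, Prod.snd_add, Prod.snd_sum, Prod.smul_snd, smul_eq_mul]
  refine ⟨fun i => ContinuousLinearMap.fst ℂ D ℂ ∘L a i, (V' (0, 1)).1,
    fun i => ContinuousLinearMap.snd ℂ D ℂ ∘L a i, (V' (0, 1)).2, fun v t => ?_, fun y => ?_,
    fun y => ?_⟩
  · have := hV' (v, t)
    rwa [ha1, ha2] at this
  · have := congrArg Prod.fst (hV'G y)
    rw [ha1] at this
    exact this.symm
  · have := congrArg Prod.snd (hV'G y)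
    rw [ha2] at this
    exact this.symm

variable {N : Type*} [NormedAddCommGroup N] [InnerProductSpace ℂ N]

/-- The homogeneous state equation `e = ∑ a_i e L_i` of a contractive row has only the zero
solution, because the adjoints of the right creation operators form a pure family. -/
theorem eq_zero_of_state_equation {D : Type*} [NormedAddCommGroup D] [InnerProductSpace ℂ D]
    {j : N →ₗᵢ[ℂ] Fock n} {L : Fin n → N →L[ℂ] N}
    (hL : ∀ i y, j (L i y) = (rightCreation [i]).adjoint (j y))
    (a : Fin n → D →L[ℂ] D) (ha : ∀ v : Fin n → D, ‖∑ i, a i (v i)‖ ^ 2 ≤ ∑ i, ‖v i‖ ^ 2)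
    {e : N →L[ℂ] D} (he : ∀ y, e y = ∑ i, a i (e (L i y))) (y : N) : e y = 0 := by
  have key : ∀ (k : ℕ) (y : N), ‖e y‖ ^ 2 ≤ ‖e‖ ^ 2 *
      ∑ w : Fin k → Fin n, ‖(rightCreation (List.ofFn w)).adjoint (j y)‖ ^ 2 := by
    intro k
    induction k with
    | zero =>
      intro y
      have h1 : (1 : Fock n →L[ℂ] Fock n).adjoint = 1 := star_one (Fock n →L[ℂ] Fock n)
      have h2 := pow_le_pow_left₀ (norm_nonneg _) (e.le_opNorm y) 2
      simpa [rightCreation_nil, h1, mul_pow] using h2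
    | succ k ih =>
      intro y
      have h2 := ha fun i => e (L i y)
      rw [← he] at h2
      rw [sum_words_succ fun α => ‖(rightCreation α).adjoint (j y)‖ ^ 2, Finset.mul_sum]
      simp only [adjoint_rightCreation_append, ← hL]
      exact h2.trans (Finset.sum_le_sum fun i _ => ih (L i y))
  have h1 := (tendsto_sum_words_adjoint_rightCreation (j y)).const_mul (‖e‖ ^ 2)
  rw [mul_zero] at h1
  have h2 := ge_of_tendsto' h1 fun k => key k y
  rw [← norm_eq_zero]
  exact (pow_eq_zero_iff two_ne_zero).1 (le_antisymm h2 (sq_nonneg _))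

/-- The defect operator `δ = (1 - A^* A)^{1/2}` of a contraction `A`, obtained as the defect operator
of the one-term row contraction `[A^*]`. -/
theorem exists_defect_sq [CompleteSpace N] {A : N →L[ℂ] N} (hA : ‖A‖ ≤ 1) :
    ∃ (D : Submodule ℂ N) (_ : CompleteSpace D) (δ : N →L[ℂ] D),
      ∀ y, ‖δ y‖ ^ 2 = ‖y‖ ^ 2 - ‖A y‖ ^ 2 := by
  let T : Fin 1 → N →L[ℂ] N := fun _ => A.adjoint
  have hAn : ∀ y, ‖A y‖ ≤ ‖y‖ := fun y => by simpa using A.le_of_opNorm_le hA y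
  have hT : IsRowContraction T := isRowContraction_of_norm_sq fun y => by
    simpa [T] using pow_le_pow_left₀ (norm_nonneg _) (hAn y) 2
  exact ⟨defectSpace T, inferInstance, defectMap T, fun y => by
    simpa [T] using norm_defect_sq hT y⟩

/-- Commutant lifting on the Fock space, in the adjoint form: a contraction `A` on a subspace that
is invariant under the adjoints of the right creation operators and on which `A` commutes with them
extends to an operator on the whole space commuting with them. -/
theorem exists_extension_of_norm_le_one [CompleteSpace N] {j : N →ₗᵢ[ℂ] Fock n}
    {L : Fin n → N →L[ℂ] N}
    (hL : ∀ i y, j (L i y) = (rightCreation [i]).adjoint (j y)) {A : N →L[ℂ] N}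
    (hA : ‖A‖ ≤ 1) (hAL : ∀ i y, A (L i y) = L i (A y)) :
    ∃ Y : Fock n →L[ℂ] Fock n,
      (∀ i y, (rightCreation [i]).adjoint (Y y) = Y ((rightCreation [i]).adjoint y)) ∧
      ∀ y : N, Y (j y) = j (A y) := by
  obtain ⟨D, _, δ, hδ⟩ := exists_defect_sq hA
  let ε : N →L[ℂ] ℂ := innerSL ℂ (fockBasis []) ∘L j.toContinuousLinearMap
  have hε : ∀ y, ε y = j y [] := fun y => inner_fockBasis_left _ _
  have hsplit : ∀ y : N, ‖y‖ ^ 2 = ‖ε y‖ ^ 2 + ∑ i, ‖L i y‖ ^ 2 := fun y => by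
    have := norm_sq_eq_right (j y)
    simpa only [← hL, ← hε, j.norm_map] using this
  have henergy : ∀ y, ‖δ y‖ ^ 2 + ‖(ε ∘L A) y‖ ^ 2
      = ∑ i, ‖(δ ∘L L i) y‖ ^ 2 + ‖ε y‖ ^ 2 := fun y => by
    have h3 : ∑ i, ‖A (L i y)‖ ^ 2 = ∑ i, ‖L i (A y)‖ ^ 2 := by simp only [hAL]
    simp only [ContinuousLinearMap.comp_apply, hδ, Finset.sum_sub_distrib]
    linarith [hsplit y, hsplit (A y)]
  obtain ⟨a, b, c, d, hcol, hδa, hεc⟩ := exists_colligation (fun i => δ ∘L L i) ε δ (ε ∘L A) henergy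
  simp only [ContinuousLinearMap.comp_apply, hε] at hδa hεc
  obtain ⟨s, Y, hs, hY0, hYR⟩ := exists_transfer a b c d hcol
  -- Both `δ` and `s` satisfy the state equation on `N`, whose solution is unique.
  have hδs : ∀ y : N, δ y = s (j y) := fun y => by
    refine sub_eq_zero.1 (eq_zero_of_state_equation hL a (fun v => ?_)
      (e := δ - s ∘L j.toContinuousLinearMap) (fun y => ?_) y)
    · have h2 := hcol v 0
      rw [zero_smul, add_zero, norm_zero, zero_pow two_ne_zero, add_zero] at h2
      exact (le_add_of_nonneg_right (sq_nonneg _)).trans h2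
    · change δ y - s (j y) = ∑ i, a i (δ (L i y) - s (j (L i y)))
      simp only [map_sub, Finset.sum_sub_distrib, hL]
      rw [hδa, hs, add_sub_add_right_eq_sub]
  refine ⟨Y, hYR, fun y => ?_⟩
  ext α
  induction α using List.reverseRecOn generalizing y with
  | nil =>
    rw [hY0, hεc]
    simp only [hδs, hL]
  | append_singleton α i ih =>
    rw [← adjoint_rightCreation_apply, ← adjoint_rightCreation_apply, hYR, ← hL, ← hL, ih, hAL]

end Lifting

section Constrained

variable {n : ℕ} {J : TwoSidedIdeal (toeplitzAlgebra n)}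

theorem adjoint_compression_rightCreation (i : Fin n) (y : constrainedSpace J) :
    ((compression J (rightCreation [i])).adjoint y : Fock n)
      = (rightCreation [i]).adjoint (y : Fock n) := by
  refine ext_inner_right ℂ fun x => ?_
  have h1 : (constrainedProj J).adjoint ((compression J (rightCreation [i])).adjoint y)
      = (rightCreation [i]).adjoint ((constrainedProj J).adjoint y) := by
    refine ext_inner_right ℂ fun x => ?_
    simp only [ContinuousLinearMap.adjoint_inner_left]
    rw [compression_constrainedProj fun x hx => rightCreation_apply_mem_idealSpace i hx]
  rw [adjoint_constrainedProj_apply, adjoint_constrainedProj_apply] at h1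
  rw [h1]

/-- An operator on `𝓝_J` that commutes with the compressed right creation operators is the
compression of an element of the noncommutative analytic Toeplitz algebra. -/
theorem exists_compression_eq {X : constrainedSpace J →L[ℂ] constrainedSpace J}
    (hX : X ∈ Subalgebra.centralizer ℂ
      (Set.range fun i : Fin n => compression J (rightCreation [i]))) :
    ∃ f : toeplitzAlgebra n, compression J f.1 = X := by
  set C : Fin n → constrainedSpace J →L[ℂ] constrainedSpace J :=
    fun i => compression J (rightCreation [i]) with hC
  have hXC : ∀ i, C i ∘L X = X ∘L C i := fun i =>
    (Subalgebra.mem_centralizer_iff ℂ).1 hX _ ⟨i, rfl⟩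
  set ρ : ℝ := ‖X‖ + 1 with hρ
  have hρ0 : (ρ : ℂ) ≠ 0 := Complex.ofReal_ne_zero.2 (by positivity)
  obtain ⟨Y, hYR, hYX⟩ := exists_extension_of_norm_le_one
    (j := (constrainedSpace J).subtypeₗᵢ) (L := fun i => (C i).adjoint)
    adjoint_compression_rightCreation (A := (ρ : ℂ)⁻¹ • X.adjoint)
    (ContinuousLinearMap.opNorm_le_bound _ zero_le_one fun y => by
      rw [smul_apply, norm_smul, norm_inv, Complex.norm_real, Real.norm_of_nonneg (by positivity),
        inv_mul_le_iff₀ (by positivity)]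
      have h1 : ‖X.adjoint‖ = ‖X‖ := ContinuousLinearMap.adjoint.norm_map X
      have h2 := X.adjoint.le_opNorm y
      rw [h1] at h2
      nlinarith [norm_nonneg y])
    (fun i y => by
      have h1 := congrArg ContinuousLinearMap.adjoint (hXC i)
      rw [ContinuousLinearMap.adjoint_comp, ContinuousLinearMap.adjoint_comp] at h1
      have h2 := DFunLike.congr_fun h1 y
      simp only [ContinuousLinearMap.comp_apply] at h2
      rw [smul_apply, smul_apply, map_smul, h2])
  have hf : Y.adjoint ∈ rightCommutant n := mem_rightCommutant_iff.2 fun i x => by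
    refine ext_inner_left ℂ fun y => ?_
    rw [ContinuousLinearMap.adjoint_inner_right, ← ContinuousLinearMap.adjoint_inner_left, hYR,
      ← ContinuousLinearMap.adjoint_inner_right, ContinuousLinearMap.adjoint_inner_left]
  have hYX' : ∀ y : constrainedSpace J, Y (y : Fock n)
      = (((ρ : ℂ)⁻¹ • X.adjoint) y : constrainedSpace J) := hYX
  refine ⟨⟨(ρ : ℂ) • Y.adjoint,
    (toeplitzAlgebra n).smul_mem (rightCommutant_le_toeplitzAlgebra hf) _⟩, ?_⟩
  ext1 u
  refine ext_inner_left ℂ fun v => ?_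
  change ⟪v, constrainedProj J ((ρ : ℂ) • Y.adjoint (u : Fock n))⟫_ℂ = _
  rw [← ContinuousLinearMap.adjoint_inner_left, adjoint_constrainedProj_apply, inner_smul_right,
    ContinuousLinearMap.adjoint_inner_right, hYX', smul_apply, Submodule.coe_smul, inner_smul_left,
    map_inv₀, Complex.conj_ofReal, mul_inv_cancel_left₀ hρ0, ← Submodule.coe_inner,
    ContinuousLinearMap.adjoint_inner_left]

end Constrained

end ConstrainedShift

end

theorem theorem1p1 {n : ℕ} {H : Type*} [NormedAddCommGroup H] [InnerProductSpace ℂ H]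
    [CompleteSpace H]
    (J : TwoSidedIdeal (ConstrainedShift.toeplitzAlgebra n))
    (hJ_closed : ConstrainedShift.IsWOTClosed
      {A : ConstrainedShift.Fock n →L[ℂ] ConstrainedShift.Fock n | ∃ φ ∈ J, φ.1 = A})
    (hJ_ne : J ≠ ⊤)
    (T : Fin n → H →L[ℂ] H)
    (hT : ConstrainedShift.IsRowContraction T)
    (hT_cnc : ConstrainedShift.IsCompletelyNonCoisometric T)
    (hT_J : ∀ φ ∈ J, ConstrainedShift.HasFunctionalCalculus φ T 0) :
    (∀ X : ConstrainedShift.constrainedSpace J →L[ℂ] ConstrainedShift.constrainedSpace J,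
      X ∈ ConstrainedShift.weakStarAlgebra (ConstrainedShift.constrainedShift J) ↔
        ∃ f : ConstrainedShift.toeplitzAlgebra n,
          ConstrainedShift.HasFunctionalCalculus f (ConstrainedShift.constrainedShift J) X) ∧
    ∀ f : ConstrainedShift.toeplitzAlgebra n,
      ∃ (fT : H →L[ℂ] H)
        (fB : ConstrainedShift.constrainedSpace J →L[ℂ] ConstrainedShift.constrainedSpace J),
        ConstrainedShift.HasFunctionalCalculus f T fT ∧
        ConstrainedShift.HasFunctionalCalculus f (ConstrainedShift.constrainedShift J) fB ∧
        ConstrainedShift.constrainedPoissonKernel J T hT ∘L fT.adjoint =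
          ConstrainedShift.tensorOp fB.adjoint
              (ContinuousLinearMap.id ℂ (ConstrainedShift.defectSpace T)) ∘L
            ConstrainedShift.constrainedPoissonKernel J T hT := by
  refine ⟨fun X => ⟨fun hX => ?_, fun ⟨f, hf⟩ =>
    ConstrainedShift.mem_weakStarAlgebra_of_hasFunctionalCalculus hf⟩, fun f => ?_⟩
  · obtain ⟨f, rfl⟩ := ConstrainedShift.exists_compression_eq
      (ConstrainedShift.weakStarAlgebra_le_centralizer hX)
    exact ⟨f, ConstrainedShift.hasFunctionalCalculus_compression f⟩
  · obtain ⟨A, hA, hAK⟩ := ConstrainedShift.exists_hasFunctionalCalculus hT hT_cnc f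
    exact ⟨A, ConstrainedShift.compression J f.1, hA,
      ConstrainedShift.hasFunctionalCalculus_compression f,
      ConstrainedShift.constrainedPoissonKernel_intertwine hT hT_cnc hT_J hAK⟩
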